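/- Let $(M^n,\langle\cdot,\cdot\rangle)$ be a simply connected (in particular connected) smooth Riemannian manifold and let $f:M^n\to\mathbb R^{n+1}$ be a smooth isometric immersion with smooth unit normal vector field $N$. Let $A$ be the shape operator associated with $N$, so that $dN(X)=-df(AX)$, and let $\nabla$ be the Levi-Civita connection of $\langle\cdot,\cdot\rangle$. Let $Q$ be a Codazzi tensor on $M^n$, i.e. a smooth self-adjoint $(1,1)$-tensor field with $(\nabla_XQ)Y=(\nabla_YQ)X$ for all tangent vector fields $X,Y$, where $(\nabla_XQ)Y=\nabla_X(QY)-Q(\nabla_XY)$. Assume that $Q$ is non-singular (invertible at every point) and that $Q\circ A=A\circ Q$. Then there exist: (i) a smooth immersion $F:M^n\to\mathbb R^{n+1}$ such that $dF=df\circ Q$, and (ii) smooth functions $g,h:M^n\to\mathbb R$ such that $A(\operatorname{grad} g)=-\operatorname{grad} h$, $QX=\nabla_X\operatorname{grad} g-hAX$ for every tangent vector $X$, and $F=df(\operatorname{grad} g)+hN$. Furthermore, $\widetilde{\langle X,Y\rangle}=\langle Q^2X,Y\rangle$ defines a Riemannian metric on $M^n$, and $F$ is an isometric immersion of $(M^n,\widetilde{\langle\cdot,\cdot\rangle})$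 into $\mathbb R^{n+1}$. -/

import Mathlib

open Bundle NormedSpace VectorField
open scoped Manifold ContDiff

namespace CodazziHypersurface

noncomputable section

/-- A smooth Riemannian metric on an `n`-dimensional manifold `M`. -/
abbrev Metric (n : ℕ) (M : Type*) [TopologicalSpace M]
    [ChartedSpace (EuclideanSpace ℝ (Fin n)) M] [IsManifold (𝓡 n) ∞ M] :=
  ContMDiffRiemannianMetric (𝓡 n) ∞ (EuclideanSpace ℝ (Fin n))
    (fun x : M ↦ TangentSpace (𝓡 n) x)

variable {n : ℕ} {M : Type*} [TopologicalSpace M]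
  [ChartedSpace (EuclideanSpace ℝ (Fin n)) M] [IsManifold (𝓡 n) ∞ M]

instance instFiniteDimensionalTangent (x : M) : FiniteDimensional ℝ (TangentSpace (𝓡 n) x) :=
  inferInstanceAs (FiniteDimensional ℝ (EuclideanSpace ℝ (Fin n)))

instance instT2Tangent (x : M) : T2Space (TangentSpace (𝓡 n) x) :=
  inferInstanceAs (T2Space (EuclideanSpace ℝ (Fin n)))

/-- A vector field on `M` (not necessarily smooth). -/
abbrev VField (n : ℕ) (M : Type*) [TopologicalSpace M]
    [ChartedSpace (EuclideanSpace ℝ (Fin n)) M] :=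
  Π x : M, TangentSpace (𝓡 n) x

/-- The vector field `X` is differentiable at `x`. -/
abbrev DiffFieldAt (X : VField n M) (x : M) : Prop :=
  MDifferentiableAt (𝓡 n) ((𝓡 n).prod 𝓘(ℝ, EuclideanSpace ℝ (Fin n)))
    (fun y ↦ TotalSpace.mk' (EuclideanSpace ℝ (Fin n))
      (E := fun y : M ↦ TangentSpace (𝓡 n) y) y (X y)) x

/-- The vector field `X` is smooth at `x`. -/
abbrev SmoothFieldAt (X : VField n M) (x : M) : Prop :=
  ContMDiffAt (𝓡 n) ((𝓡 n).prod 𝓘(ℝ, EuclideanSpace ℝ (Fin n))) ∞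
    (fun y ↦ TotalSpace.mk' (EuclideanSpace ℝ (Fin n))
      (E := fun y : M ↦ TangentSpace (𝓡 n) y) y (X y)) x

/-! ### The musical isomorphism and the gradient -/

theorem flat_injective (m : Metric n M) (x : M) :
    Function.Injective
      ((ContinuousLinearMap.coeLM ℝ).comp (m.inner x : TangentSpace (𝓡 n) x →ₗ[ℝ]
        (TangentSpace (𝓡 n) x →L[ℝ] ℝ)) :
        TangentSpace (𝓡 n) x →ₗ[ℝ] Module.Dual ℝ (TangentSpace (𝓡 n) x)) := by
  rw [injective_iff_map_eq_zero]
  intro v hv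
  by_contra h
  have h1 := m.pos x v h
  have h2 := LinearMap.congr_fun hv v
  simp at h2
  exact h1.ne' h2

/-- The isomorphism `v ↦ ⟨v, ·⟩` from the tangent space at `x` to its dual. -/
def flat (m : Metric n M) (x : M) :
    TangentSpace (𝓡 n) x ≃ₗ[ℝ] Module.Dual ℝ (TangentSpace (𝓡 n) x) :=
  LinearEquiv.ofInjectiveOfFinrankEq _ (flat_injective m x) Subspace.dual_finrank_eq.symm

/-- The tangent vector `v` at `x` with `⟨v, w⟩ = ℓ w` for all `w`. -/
def sharp (m : Metric n M) (x : M) :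
    (TangentSpace (𝓡 n) x →L[ℝ] ℝ) →ₗ[ℝ] TangentSpace (𝓡 n) x :=
  (flat m x).symm.toLinearMap.comp (ContinuousLinearMap.coeLM ℝ)

theorem inner_sharp (m : Metric n M) (x : M) (ℓ : TangentSpace (𝓡 n) x →L[ℝ] ℝ)
    (w : TangentSpace (𝓡 n) x) : m.inner x (sharp m x ℓ) w = ℓ w :=
  LinearMap.congr_fun ((flat m x).apply_symm_apply (ℓ : Module.Dual ℝ (TangentSpace (𝓡 n) x))) w

/-- The gradient of a function `φ`: `⟨grad φ, w⟩ = dφ(w)`. -/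
def grad (m : Metric n M) (φ : M → ℝ) (x : M) : TangentSpace (𝓡 n) x :=
  sharp m x (mvfderiv (𝓡 n) φ x)

/-! ### The Levi-Civita connection -/

theorem mdifferentiableAt_inner (m : Metric n M) {x : M} {X Y : VField n M}
    (hX : DiffFieldAt X x) (hY : DiffFieldAt Y x) :
    MDifferentiableAt (𝓡 n) 𝓘(ℝ, ℝ) (fun y ↦ m.inner y (X y) (Y y)) x := by
  let _ : RiemannianBundle (fun x : M ↦ TangentSpace (𝓡 n) x) := ⟨m.toRiemannianMetric⟩
  exact MDifferentiableAt.inner_bundle (F := EuclideanSpace ℝ (Fin n)) hX hY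

/-- The right-hand side of the Koszul formula
`2⟨∇_X Y, Z⟩ = X⟨Y,Z⟩ + Y⟨Z,X⟩ - Z⟨X,Y⟩ + ⟨[X,Y],Z⟩ - ⟨[Y,Z],X⟩ + ⟨[Z,X],Y⟩`, halved. -/
def koszul (m : Metric n M) (Y X Z : VField n M) (x : M) : ℝ :=
  (1 / 2 : ℝ) *
    (mvfderiv (𝓡 n) (fun y ↦ m.inner y (Y y) (Z y)) x (X x)
      + mvfderiv (𝓡 n) (fun y ↦ m.inner y (Z y) (X y)) x (Y x)
      - mvfderiv (𝓡 n) (fun y ↦ m.inner y (X y) (Y y)) x (Z x)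
      + m.inner x (mlieBracket (𝓡 n) X Y x) (Z x)
      - m.inner x (mlieBracket (𝓡 n) Y Z x) (X x)
      + m.inner x (mlieBracket (𝓡 n) Z X x) (Y x))

section

variable (m : Metric n M) {x : M} {X X' Y Y' Z Z' : VField n M} {f : M → ℝ}

theorem inner_add_left' : (fun y ↦ m.inner y ((X + X') y) (Y y)) =
    (fun y ↦ m.inner y (X y) (Y y)) + fun y ↦ m.inner y (X' y) (Y y) := by
  ext y; simp

theorem inner_add_right' : (fun y ↦ m.inner y (Y y) ((X + X') y)) =
    (fun y ↦ m.inner y (Y y) (X y)) + fun y ↦ m.inner y (Y y) (X' y) := by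
  ext y; simp

theorem inner_smul_left' : (fun y ↦ m.inner y ((f • X) y) (Y y)) =
    f * fun y ↦ m.inner y (X y) (Y y) := by
  ext y; simp

theorem inner_smul_right' : (fun y ↦ m.inner y (Y y) ((f • X) y)) =
    f * fun y ↦ m.inner y (Y y) (X y) := by
  ext y; simp

theorem koszul_add_left (hY : DiffFieldAt Y x) (hX : DiffFieldAt X x)
    (hX' : DiffFieldAt X' x) (hZ : DiffFieldAt Z x) :
    koszul m Y (X + X') Z x = koszul m Y X Z x + koszul m Y X' Z x := by
  simp only [koszul, inner_add_left', inner_add_right']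
  rw [mvfderiv_add (mdifferentiableAt_inner m hZ hX) (mdifferentiableAt_inner m hZ hX'),
    mvfderiv_add (mdifferentiableAt_inner m hX hY) (mdifferentiableAt_inner m hX' hY),
    mlieBracket_add_left hX hX', mlieBracket_add_right hX hX']
  simp
  ring

theorem koszul_add_right (hY : DiffFieldAt Y x) (hX : DiffFieldAt X x)
    (hZ : DiffFieldAt Z x) (hZ' : DiffFieldAt Z' x) :
    koszul m Y X (Z + Z') x = koszul m Y X Z x + koszul m Y X Z' x := by
  simp only [koszul, inner_add_left', inner_add_right']
  rw [mvfderiv_add (mdifferentiableAt_inner m hZ hX) (mdifferentiableAt_inner m hZ' hX),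
    mvfderiv_add (mdifferentiableAt_inner m hY hZ) (mdifferentiableAt_inner m hY hZ'),
    mlieBracket_add_left hZ hZ', mlieBracket_add_right hZ hZ']
  simp
  ring

theorem koszul_add_field (hY : DiffFieldAt Y x) (hY' : DiffFieldAt Y' x)
    (hX : DiffFieldAt X x) (hZ : DiffFieldAt Z x) :
    koszul m (Y + Y') X Z x = koszul m Y X Z x + koszul m Y' X Z x := by
  simp only [koszul, inner_add_left', inner_add_right']
  rw [mvfderiv_add (mdifferentiableAt_inner m hY hZ) (mdifferentiableAt_inner m hY' hZ),
    mvfderiv_add (mdifferentiableAt_inner m hX hY) (mdifferentiableAt_inner m hX hY'),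
    mlieBracket_add_left hY hY', mlieBracket_add_right hY hY']
  simp
  ring

theorem koszul_smul_left (hf : MDifferentiableAt (𝓡 n) 𝓘(ℝ, ℝ) f x) (hY : DiffFieldAt Y x) (hX : DiffFieldAt X x)
    (hZ : DiffFieldAt Z x) :
    koszul m Y (f • X) Z x = f x * koszul m Y X Z x := by
  simp only [koszul, inner_smul_left', inner_smul_right']
  rw [mvfderiv_mul hf (mdifferentiableAt_inner m hZ hX),
    mvfderiv_mul hf (mdifferentiableAt_inner m hX hY),
    mlieBracket_smul_left hf hX, mlieBracket_smul_right hf hX]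
  simp [m.symm x (Z x) (X x)]
  ring

theorem koszul_smul_right (hf : MDifferentiableAt (𝓡 n) 𝓘(ℝ, ℝ) f x) (hY : DiffFieldAt Y x) (hX : DiffFieldAt X x)
    (hZ : DiffFieldAt Z x) :
    koszul m Y X (f • Z) x = f x * koszul m Y X Z x := by
  simp only [koszul, inner_smul_left', inner_smul_right']
  rw [mvfderiv_mul hf (mdifferentiableAt_inner m hZ hX),
    mvfderiv_mul hf (mdifferentiableAt_inner m hY hZ),
    mlieBracket_smul_left hf hZ, mlieBracket_smul_right hf hZ]
  simp [m.symm x (Z x) (X x), m.symm x (Z x) (Y x)]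
  ring

theorem koszul_smul_field (hf : MDifferentiableAt (𝓡 n) 𝓘(ℝ, ℝ) f x) (hY : DiffFieldAt Y x) (hX : DiffFieldAt X x)
    (hZ : DiffFieldAt Z x) :
    koszul m (f • Y) X Z x =
      f x * koszul m Y X Z x + mvfderiv (𝓡 n) f x (X x) * m.inner x (Y x) (Z x) := by
  simp only [koszul, inner_smul_left', inner_smul_right']
  rw [mvfderiv_mul hf (mdifferentiableAt_inner m hY hZ),
    mvfderiv_mul hf (mdifferentiableAt_inner m hX hY),
    mlieBracket_smul_left hf hY, mlieBracket_smul_right hf hY]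
  simp [m.symm x (Y x) (X x)]
  ring

/-- For a vector field `Y` differentiable at `x`, the bilinear form `(u, w) ↦ ⟨∇_u Y, w⟩`
on the tangent space at `x`. -/
def koszulForm (Y : VField n M) (x : M) (hY : DiffFieldAt Y x) :
    TangentSpace (𝓡 n) x →L[ℝ] TangentSpace (𝓡 n) x →L[ℝ] ℝ :=
  TensorialAt.mkHom₂ (I := 𝓡 n) (F := EuclideanSpace ℝ (Fin n)) (F' := EuclideanSpace ℝ (Fin n))
    (fun X Z ↦ koszul m Y X Z x) x
    (fun _ hZ ↦ ⟨fun hf hX ↦ koszul_smul_left m hf hY hX hZ,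
      fun hX hX' ↦ koszul_add_left m hY hX hX' hZ⟩)
    (fun _ hX ↦ ⟨fun hf hZ ↦ koszul_smul_right m hf hY hX hZ,
      fun hZ hZ' ↦ koszul_add_right m hY hX hZ hZ'⟩)

theorem koszulForm_apply (hY : DiffFieldAt Y x) (hX : DiffFieldAt X x)
    (hZ : DiffFieldAt Z x) : koszulForm m Y x hY (X x) (Z x) = koszul m Y X Z x :=
  TensorialAt.mkHom₂_apply _ _ hX hZ

open Classical in
/-- `leviCivitaFun m Y x u` is `∇_u Y` at `x`; it is `0` if `Y` is not differentiable at `x`. -/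
def leviCivitaFun (Y : VField n M) (x : M) :
    TangentSpace (𝓡 n) x →L[ℝ] TangentSpace (𝓡 n) x :=
  if hY : DiffFieldAt Y x then
    LinearMap.toContinuousLinearMap ((sharp m x).comp (koszulForm m Y x hY).toLinearMap)
  else 0

theorem inner_leviCivitaFun (hY : DiffFieldAt Y x) (hX : DiffFieldAt X x)
    (hZ : DiffFieldAt Z x) :
    m.inner x (leviCivitaFun m Y x (X x)) (Z x) = koszul m Y X Z x := by
  rw [leviCivitaFun, dif_pos hY, ← koszulForm_apply m hY hX hZ]
  exact inner_sharp m x _ _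

theorem eq_of_inner_eq {u v : TangentSpace (𝓡 n) x}
    (h : ∀ Z : VField n M, DiffFieldAt Z x →
      m.inner x u (Z x) = m.inner x v (Z x)) : u = v := by
  apply (flat m x).injective
  ext w
  have := h (FiberBundle.extend (EuclideanSpace ℝ (Fin n)) w)
    (FiberBundle.mdifferentiableAt_extend ..)
  rw [FiberBundle.extend_apply_self] at this
  exact this

theorem clm_eq_of_inner_eq {A B : TangentSpace (𝓡 n) x →L[ℝ] TangentSpace (𝓡 n) x}
    (h : ∀ X Z : VField n M, DiffFieldAt X x → DiffFieldAt Z x →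
      m.inner x (A (X x)) (Z x) = m.inner x (B (X x)) (Z x)) : A = B := by
  ext1 u
  have hu := FiberBundle.mdifferentiableAt_extend (𝓡 n) (EuclideanSpace ℝ (Fin n)) u
  apply eq_of_inner_eq m
  intro Z hZ
  simpa using h _ Z hu hZ

/-- The Levi-Civita connection of the metric `m`; `leviCivita m Y x u` is `∇_u Y`. -/
def leviCivita : CovariantDerivative (𝓡 n) (EuclideanSpace ℝ (Fin n))
    (fun x : M ↦ TangentSpace (𝓡 n) x) where
  toFun := leviCivitaFun m
  isCovariantDerivativeOnUniv :=
    { add := by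
        intro Y Y' x hY hY' _
        refine clm_eq_of_inner_eq m fun X Z hX hZ ↦ ?_
        rw [inner_leviCivitaFun m (mdifferentiableAt_add_section hY hY') hX hZ,
          koszul_add_field m hY hY' hX hZ]
        simp [inner_leviCivitaFun m hY hX hZ, inner_leviCivitaFun m hY' hX hZ]
      leibniz := by
        intro Y f x hY hf _
        refine clm_eq_of_inner_eq m fun X Z hX hZ ↦ ?_
        rw [inner_leviCivitaFun m (hf.smul_section hY) hX hZ, koszul_smul_field m hf hY hX hZ]
        simp [inner_leviCivitaFun m hY hX hZ] }

/-- The Levi-Civita connection is torsion-free. -/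
theorem leviCivita_torsion_free (hX : DiffFieldAt X x) (hY : DiffFieldAt Y x) :
    leviCivita m Y x (X x) - leviCivita m X x (Y x) = mlieBracket (𝓡 n) X Y x := by
  refine eq_of_inner_eq m fun Z hZ ↦ ?_
  have h1 := inner_leviCivitaFun m hY hX hZ
  have h2 := inner_leviCivitaFun m hX hY hZ
  have e : ∀ U V : VField n M,
      (fun y ↦ m.inner y (U y) (V y)) = fun y ↦ m.inner y (V y) (U y) :=
    fun U V ↦ funext fun y ↦ m.symm y _ _
  have a : m.inner x (leviCivita m Y x (X x)) (Z x) = koszul m Y X Z x := h1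
  have b : m.inner x (leviCivita m X x (Y x)) (Z x) = koszul m X Y Z x := h2
  rw [map_sub, sub_apply, a, b]
  simp only [koszul]
  rw [e Z X, e Z Y, e Y X, mlieBracket_swap_apply (V := Y) (W := X),
    mlieBracket_swap_apply (V := X) (W := Z), mlieBracket_swap_apply (V := Z) (W := Y)]
  simp
  ring

/-- The Levi-Civita connection is compatible with the metric. -/
theorem leviCivita_metric (hX : DiffFieldAt X x) (hY : DiffFieldAt Y x)
    (hZ : DiffFieldAt Z x) :
    mvfderiv (𝓡 n) (fun y ↦ m.inner y (Y y) (Z y)) x (X x) =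
      m.inner x (leviCivita m Y x (X x)) (Z x) + m.inner x (Y x) (leviCivita m Z x (X x)) := by
  have a : m.inner x (leviCivita m Y x (X x)) (Z x) = koszul m Y X Z x :=
    inner_leviCivitaFun m hY hX hZ
  have b : m.inner x (leviCivita m Z x (X x)) (Y x) = koszul m Z X Y x :=
    inner_leviCivitaFun m hZ hX hY
  have e : ∀ U V : VField n M,
      (fun y ↦ m.inner y (U y) (V y)) = fun y ↦ m.inner y (V y) (U y) :=
    fun U V ↦ funext fun y ↦ m.symm y _ _
  rw [m.symm x (Y x), a, b]
  simp only [koszul]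
  rw [e Z X, e Y X, e Z Y, mlieBracket_swap_apply (V := Y) (W := X),
    mlieBracket_swap_apply (V := X) (W := Z), mlieBracket_swap_apply (V := Z) (W := Y)]
  simp
  ring

end

/-! ### Immersions, shape operators and Codazzi tensors -/

/-- A field of endomorphisms of the tangent spaces, i.e. a (1,1)-tensor field (not necessarily
smooth). -/
abbrev EndoField (n : ℕ) (M : Type*) [TopologicalSpace M]
    [ChartedSpace (EuclideanSpace ℝ (Fin n)) M] :=
  Π x : M, TangentSpace (𝓡 n) x →L[ℝ] TangentSpace (𝓡 n) x

/-- Smoothness of a (1,1)-tensor field, as a section of the bundle `Hom(TM, TM)`. -/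
def EndoField.Smooth (Q : EndoField n M) : Prop :=
  ContMDiff (𝓡 n)
    ((𝓡 n).prod 𝓘(ℝ, EuclideanSpace ℝ (Fin n) →L[ℝ] EuclideanSpace ℝ (Fin n))) ∞
    (fun x ↦ TotalSpace.mk' (EuclideanSpace ℝ (Fin n) →L[ℝ] EuclideanSpace ℝ (Fin n))
      (E := fun x : M ↦ TangentSpace (𝓡 n) x →L[ℝ] TangentSpace (𝓡 n) x) x (Q x))

/-- A Codazzi tensor: a smooth self-adjoint (1,1)-tensor field `Q` such that
`(∇_X Q) Y = (∇_Y Q) X`, where `(∇_X Q) Y = ∇_X (Q Y) - Q (∇_X Y)`, at every point `x` and for all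
vector fields `X`, `Y` that are smooth at `x`. -/
structure IsCodazzi (m : Metric n M) (Q : EndoField n M) : Prop where
  smooth : Q.Smooth
  selfAdjoint : ∀ (x : M) (u v : TangentSpace (𝓡 n) x),
    m.inner x (Q x u) v = m.inner x u (Q x v)
  codazzi : ∀ (x : M) (X Y : VField n M),
    SmoothFieldAt X x → SmoothFieldAt Y x →
      leviCivita m (fun y ↦ Q y (Y y)) x (X x) - Q x (leviCivita m Y x (X x)) =
        leviCivita m (fun y ↦ Q y (X y)) x (Y x) - Q x (leviCivita m X x (Y x))

/-- The differential at `x` of a map into Euclidean space. -/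
abbrev diff {k : ℕ} (f : M → EuclideanSpace ℝ (Fin k)) (x : M) :
    TangentSpace (𝓡 n) x →L[ℝ] EuclideanSpace ℝ (Fin k) :=
  mvfderiv (𝓡 n) f x

/-- A smooth immersion of `M` into Euclidean space. -/
def IsSmoothImmersion {k : ℕ} (f : M → EuclideanSpace ℝ (Fin k)) : Prop :=
  ContMDiff (𝓡 n) (𝓡 k) ∞ f ∧ ∀ x, Function.Injective (diff (n := n) f x)

/-- An isometric immersion of the Riemannian manifold `(M, m)` into Euclidean space. -/
def IsIsometricImmersion {k : ℕ} (m : Metric n M) (f : M → EuclideanSpace ℝ (Fin k)) : Prop :=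
  IsSmoothImmersion (n := n) f ∧
    ∀ (x : M) (u v : TangentSpace (𝓡 n) x), inner ℝ (diff f x u) (diff f x v) = m.inner x u v

/-- A smooth unit normal vector field along `f`. -/
structure IsUnitNormal (f N : M → EuclideanSpace ℝ (Fin (n + 1))) : Prop where
  smooth : ContMDiff (𝓡 n) (𝓡 (n + 1)) ∞ N
  norm_eq_one : ∀ x, ‖N x‖ = 1
  normal : ∀ (x : M) (u : TangentSpace (𝓡 n) x), inner ℝ (diff f x u) (N x) = 0

/-- The shape operator `A` of an isometric immersion `f` associated with the unit normal field `N`,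
given by `⟨A u, v⟩ = -⟨dN(u), df(v)⟩`. -/
def shapeOperator (m : Metric n M) (f N : M → EuclideanSpace ℝ (Fin (n + 1))) : EndoField n M :=
  fun x ↦ LinearMap.toContinuousLinearMap
    { toFun := fun u ↦ -sharp m x ((innerSL ℝ (diff N x u)).comp (diff f x))
      map_add' := fun u v ↦ by simp [ContinuousLinearMap.add_comp]; abel
      map_smul' := fun c u ↦ by simp [ContinuousLinearMap.smul_comp] }

theorem inner_shapeOperator (m : Metric n M) (f N : M → EuclideanSpace ℝ (Fin (n + 1))) (x : M)
    (u v : TangentSpace (𝓡 n) x) :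
    m.inner x (shapeOperator m f N x u) v = -inner ℝ (diff N x u) (diff f x v) := by
  have := inner_sharp m x ((innerSL ℝ (diff N x u)).comp (diff f x)) v
  simp [shapeOperator] at this ⊢
  exact this

end

end CodazziHypersurface

open CodazziHypersurface

/-! Both `F` and `g` are primitives of closed one-forms, and simple connectedness supplies them
(`exists_primitive`).

The form df ∘ Q is closed (`closedOneForm_diffComp`). By the Gauss formula `diff_diff`, X(df(QY)) -
Y(df(QX)) has tangential part ∇_X(QY) - ∇_Y(QX), which is Q[X,Y] because Q is Codazzi and ∇ is
torsion-free. Its normal part is ⟨AX,QY⟩ - ⟨AY,QX⟩, which vanishes because A and Q are self-adjoint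
and commute. A primitive F is an immersion since Q is invertible, and it induces ⟨QX,QY⟩ = ⟨Q²X,Y⟩.

The form X ↦ ⟨F, df(X)⟩ is closed (`closedOneForm_innerDiff`), since ⟨dF(X), df(Y)⟩ = ⟨QX,Y⟩ is
symmetric. If g is a primitive, df(grad g) is the tangential part of F, so F = df(grad g) + hN with
h = ⟨F,N⟩. Differentiating this identity (`diff_support`) and comparing with dF = df ∘ Q gives QX =
∇_X grad g - hAX tangentially and ⟨AX, grad g⟩ + dh(X) = 0 normally; the latter is A(grad g) = -grad
h.

For `exists_primitive`, the Poincaré lemma on a ball in a chart gives local primitives. Their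
differences are locally constant, so their germs form a covering space, and a global section of it
is a global primitive. -/

namespace CodazziHypersurface

noncomputable section

open Set Filter Topology

/-! ### Gluing local functions over a simply connected space -/

/-- The bundle of germs of functions that differ from the local functions `u i` by a locally
constant function. -/
def translationBundleCore {B V : Type*} [TopologicalSpace B] [AddCommGroup V] [TopologicalSpace V]
    [DiscreteTopology V] (U : B → Set B) (hU : ∀ i, IsOpen (U i)) (hmem : ∀ i, i ∈ U i)
    (u : B → B → V)
    (hu : ∀ i j, ∀ x ∈ U i ∩ U j, ∀ᶠ y in 𝓝 x, u i y - u j y = u i x - u j x) :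
    FiberBundleCore B B V where
  baseSet := U
  isOpen_baseSet := hU
  indexAt := id
  mem_baseSet_at := hmem
  -- Coordinate v over index i stands for the germ of `u i` + v at x; over j the same germ is `u j`
  -- + (v + `u i x` - `u j x`).
  coordChange i j x v := v + (u i x - u j x)
  coordChange_self := by simp
  continuousOn_coordChange i j := by
    rintro ⟨x, v⟩ ⟨hx, -⟩
    refine ContinuousAt.continuousWithinAt ?_
    have h : ∀ᶠ p : B × V in 𝓝 (x, v), p.2 + (u i p.1 - u j p.1) = v + (u i x - u j x) := by
      have h1 : ∀ᶠ p : B × V in 𝓝 (x, v), u i p.1 - u j p.1 = u i x - u j x :=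
        (continuousAt_fst (p := (x, v))).eventually (hu i j x hx)
      have h2 : ∀ᶠ p : B × V in 𝓝 (x, v), p.2 = v :=
        continuousAt_snd.eventually (p := fun w ↦ w = v) (by simp [nhds_discrete])
      filter_upwards [h1, h2] with p h1 h2
      rw [h1, h2]
    exact (continuousAt_const (y := v + (u i x - u j x))).congr
      (h.mono fun p hp ↦ hp.symm)
  coordChange_comp := by
    intros; abel

/-- On a simply connected space, local functions whose differences are locally constant glue up to
locally constant functions. -/
theorem exists_global_of_locally_constant_sub {B V : Type*} [TopologicalSpace B] [AddCommGroup V]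
    [SimplyConnectedSpace B] [LocallyPathConnectedSpace B]
    (U : B → Set B) (hU : ∀ i, IsOpen (U i)) (hmem : ∀ i, i ∈ U i) (u : B → B → V)
    (hu : ∀ i j, ∀ x ∈ U i ∩ U j, ∀ᶠ y in 𝓝 x, u i y - u j y = u i x - u j x) :
    ∃ F : B → V, ∀ x, ∀ᶠ y in 𝓝 x, F y - u x y = F x - u x x := by
  -- Discrete fibres make the bundle projection a covering map.
  let _ : TopologicalSpace V := ⊥
  have : DiscreteTopology V := ⟨rfl⟩
  let Z := translationBundleCore U hU hmem u hu
  have cov : IsCoveringMap Z.proj := FiberBundle.isCoveringMap (F := V) (E := Z.Fiber)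
  obtain ⟨x₀⟩ : Nonempty B := inferInstance
  -- Lifting the identity through the covering gives a global section. The value 0 over x₀ is an
  -- arbitrary normalization.
  obtain ⟨s, ⟨-, hs⟩, -⟩ := cov.existsUnique_continuousMap_lifts (ContinuousMap.id B) x₀
    (⟨x₀, (0 : V)⟩ : Z.TotalSpace) rfl
  have hs' : ∀ x, (s x).1 = x := fun x ↦ congrFun hs x
  let val : Z.TotalSpace → V := fun p ↦ p.2
  -- `c i` is the section read over index i, that is, the sought function minus `u i`. It is
  -- continuous into a discrete space, hence locally constant.
  let c : B → B → V := fun i x ↦ (Z.localTriv i (s x)).2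
  have hc : ∀ i x, c i x = val (s x) + (u x x - u i x) := by
    intro i x
    change val (s x) + (u (s x).1 (s x).1 - u i (s x).1) = _
    rw [hs' x]
  refine ⟨fun x ↦ val (s x) + u x x, fun x ↦ ?_⟩
  have hcont : ContinuousAt (c x) x := by
    have h1 : ContinuousAt (Z.localTriv x) (s x) := by
      refine (Z.localTriv x).continuousAt ?_
      rw [(Z.localTriv x).mem_source]
      change (s x).1 ∈ U x
      rw [hs' x]
      exact hmem x
    exact continuousAt_snd.comp (h1.comp s.continuous.continuousAt)
  have h2 : ∀ᶠ y in 𝓝 x, c x y = c x x :=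
    hcont.eventually (p := fun w ↦ w = c x x) (by simp [nhds_discrete])
  filter_upwards [h2] with y hy
  rw [hc, hc] at hy
  simp only [add_sub_assoc]
  exact hy

/-! ### Closed one-forms and the Poincaré lemma -/

section OneForms

variable {E : Type*} [NormedAddCommGroup E] [NormedSpace ℝ E]
  {M : Type*} [TopologicalSpace M] [ChartedSpace E M] [IsManifold 𝓘(ℝ, E) ∞ M]
  {V : Type*} [NormedAddCommGroup V] [NormedSpace ℝ V]

theorem _root_.HasMFDerivAt.of_eq {f : M → V} {x : M} {L L' : TangentSpace 𝓘(ℝ, E) x →L[ℝ] V}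
    (h : HasMFDerivAt 𝓘(ℝ, E) 𝓘(ℝ, V) f x L) (e : L = L') :
    HasMFDerivAt 𝓘(ℝ, E) 𝓘(ℝ, V) f x L' :=
  e ▸ h

/-! ### Coordinate vector fields -/

/-- The coordinate vector field with constant value `b` in the chart at `x₀`. -/
def coordField (x₀ : M) (b : E) (x : M) : TangentSpace 𝓘(ℝ, E) x :=
  mpullback 𝓘(ℝ, E) 𝓘(ℝ, E) (extChartAt 𝓘(ℝ, E) x₀) (fun _ ↦ b) x

theorem contMDiffAt_const_field (b z : E) :
    ContMDiffAt 𝓘(ℝ, E) 𝓘(ℝ, E).tangent ∞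
      (fun y : E ↦ TotalSpace.mk' E (E := fun y : E ↦ TangentSpace 𝓘(ℝ, E) y) y b) z := by
  have h : ContDiffAt ℝ ∞ (fun _ : E ↦ b) z := contDiffAt_const
  exact contMDiffAt_vectorSpace_iff_contDiffAt.2 h

theorem contMDiffAt_coordField [CompleteSpace E] {x₀ y : M} (hy : y ∈ (extChartAt 𝓘(ℝ, E) x₀).source) (b : E) :
    ContMDiffAt 𝓘(ℝ, E) 𝓘(ℝ, E).tangent ∞
      (fun y : M ↦ TotalSpace.mk' E (E := fun y : M ↦ TangentSpace 𝓘(ℝ, E) y) y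
        (coordField x₀ b y)) y := by
  refine ContMDiffAt.mpullback_vectorField_preimage (n := ∞) (contMDiffAt_const_field b _) ?_
    (isInvertible_mfderiv_extChartAt hy) (by simp)
  exact contMDiffAt_extChartAt' (by simpa using hy)

theorem mfderiv_coordField {x₀ y : M} (hy : y ∈ (extChartAt 𝓘(ℝ, E) x₀).source) (b : E) :
    mfderiv 𝓘(ℝ, E) 𝓘(ℝ, E) (extChartAt 𝓘(ℝ, E) x₀) y (coordField x₀ b y) = b :=
  (isInvertible_mfderiv_extChartAt hy).self_apply_inverse _

/-- Pullback commutes with the Lie bracket, and constant fields on a vector space commute. -/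
theorem mlieBracket_coordField [CompleteSpace E] {x₀ y : M} (hy : y ∈ (extChartAt 𝓘(ℝ, E) x₀).source) (a b : E) :
    mlieBracket 𝓘(ℝ, E) (coordField x₀ a) (coordField x₀ b) y = 0 := by
  have : IsManifold 𝓘(ℝ, E) (minSmoothness ℝ 2) M := 
    IsManifold.of_le (n := ∞) (by simpa using ENat.LEInfty.out)
  have h := mpullback_mlieBracket (I := 𝓘(ℝ, E)) (I' := 𝓘(ℝ, E))
    (n := ∞) (f := extChartAt 𝓘(ℝ, E) x₀) (x₀ := y)
    ((contMDiffAt_const_field a _).mdifferentiableAt (by simp))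
    ((contMDiffAt_const_field b _).mdifferentiableAt (by simp))
    (contMDiffAt_extChartAt' (by simpa using hy)) (by simpa using ENat.LEInfty.out)
  refine h.symm.trans ?_
  have h0 : ∀ z : E, mlieBracket 𝓘(ℝ, E) (fun _ : E ↦ a) (fun _ : E ↦ b) z = 0 := fun z ↦
    (congrFun (mlieBracketWithin_eq_lieBracketWithin (s := univ) (V := fun _ : E ↦ a)
      (W := fun _ : E ↦ b)) z).trans (by simp [lieBracketWithin]; rfl)
  exact (congrArg _ (h0 _)).trans (map_zero _)

/-! ### One-forms -/

/-- A vector-valued one-form is smooth if it maps smooth vector fields to smooth functions. -/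
def SmoothOneForm (η : Π x : M, TangentSpace 𝓘(ℝ, E) x →L[ℝ] V) : Prop :=
  ∀ (x : M) (X : Π x : M, TangentSpace 𝓘(ℝ, E) x),
    ContMDiffAt 𝓘(ℝ, E) 𝓘(ℝ, E).tangent ∞
      (fun y : M ↦ TotalSpace.mk' E (E := fun y : M ↦ TangentSpace 𝓘(ℝ, E) y) y (X y)) x →
    ContMDiffAt 𝓘(ℝ, E) 𝓘(ℝ, V) ∞ (fun y ↦ η y (X y)) x

/-- A vector-valued one-form `η` is closed if `X (η Y) - Y (η X) = η [X, Y]`. -/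
def ClosedOneForm (η : Π x : M, TangentSpace 𝓘(ℝ, E) x →L[ℝ] V) : Prop :=
  ∀ (x : M) (X Y : Π x : M, TangentSpace 𝓘(ℝ, E) x),
    ContMDiffAt 𝓘(ℝ, E) 𝓘(ℝ, E).tangent ∞
      (fun y : M ↦ TotalSpace.mk' E (E := fun y : M ↦ TangentSpace 𝓘(ℝ, E) y) y (X y)) x →
    ContMDiffAt 𝓘(ℝ, E) 𝓘(ℝ, E).tangent ∞
      (fun y : M ↦ TotalSpace.mk' E (E := fun y : M ↦ TangentSpace 𝓘(ℝ, E) y) y (Y y)) x →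
    mvfderiv 𝓘(ℝ, E) (fun y ↦ η y (Y y)) x (X x) - mvfderiv 𝓘(ℝ, E) (fun y ↦ η y (X y)) x (Y x) =
      η x (mlieBracket 𝓘(ℝ, E) X Y x)

/-- The one-form `η` written in the chart at `x₀`. -/
def chartForm (η : Π x : M, TangentSpace 𝓘(ℝ, E) x →L[ℝ] V) (x₀ : M) (z : E) : E →L[ℝ] V :=
  (η ((extChartAt 𝓘(ℝ, E) x₀).symm z)).comp
    (mfderiv 𝓘(ℝ, E) 𝓘(ℝ, E) (extChartAt 𝓘(ℝ, E) x₀) ((extChartAt 𝓘(ℝ, E) x₀).symm z)).inverse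

variable {η : Π x : M, TangentSpace 𝓘(ℝ, E) x →L[ℝ] V}

theorem chartForm_apply (x₀ : M) (z b : E) : chartForm η x₀ z b =
    η ((extChartAt 𝓘(ℝ, E) x₀).symm z) (coordField x₀ b ((extChartAt 𝓘(ℝ, E) x₀).symm z)) :=
  rfl

theorem chartForm_comp_mfderiv {x₀ y : M} (hy : y ∈ (extChartAt 𝓘(ℝ, E) x₀).source) :
    (chartForm η x₀ (extChartAt 𝓘(ℝ, E) x₀ y)).comp
      (mfderiv 𝓘(ℝ, E) 𝓘(ℝ, E) (extChartAt 𝓘(ℝ, E) x₀) y) = η y := by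
  ext v
  have h := (isInvertible_mfderiv_extChartAt (I := 𝓘(ℝ, E)) hy).inverse_apply_self v
  change η _ ((mfderiv 𝓘(ℝ, E) 𝓘(ℝ, E) (extChartAt 𝓘(ℝ, E) x₀) _).inverse _) = _
  rw [(extChartAt 𝓘(ℝ, E) x₀).left_inv hy]
  exact congrArg (η y) h

/-- In finite dimension smoothness can be tested on each fixed vector b, where the form becomes η
applied to a smooth coordinate field. -/
theorem contDiffOn_chartForm [FiniteDimensional ℝ E] (hω : SmoothOneForm η) (x₀ : M) :
    ContDiffOn ℝ ∞ (chartForm η x₀) (extChartAt 𝓘(ℝ, E) x₀).target := by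
  have := FiniteDimensional.complete ℝ E
  rw [contDiffOn_clm_apply]
  intro b z hz
  have hy := (extChartAt 𝓘(ℝ, E) x₀).map_target hz
  have h1 := hω _ _ (contMDiffAt_coordField hy b)
  have h2 : ContMDiffAt 𝓘(ℝ, E) 𝓘(ℝ, E) ∞ (extChartAt 𝓘(ℝ, E) x₀).symm z :=
    ((contMDiffOn_extChartAt_symm x₀) z hz).contMDiffAt
      ((isOpen_extChartAt_target x₀).mem_nhds hz)
  exact (h1.comp z h2).contDiffAt.contDiffWithinAt

theorem fderiv_chartForm [FiniteDimensional ℝ E] (hω : SmoothOneForm η) {x₀ : M} {z : E}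
    (hz : z ∈ (extChartAt 𝓘(ℝ, E) x₀).target) (a b : E) :
    fderiv ℝ (chartForm η x₀) z a b =
      mvfderiv 𝓘(ℝ, E) (fun y ↦ η y (coordField x₀ b y)) ((extChartAt 𝓘(ℝ, E) x₀).symm z)
        (coordField x₀ a ((extChartAt 𝓘(ℝ, E) x₀).symm z)) := by
  set φ := extChartAt 𝓘(ℝ, E) x₀ with hφ
  have hy := φ.map_target hz
  have hd : DifferentiableAt ℝ (chartForm η x₀) z :=
    ((contDiffOn_chartForm hω x₀).contDiffAt
      ((isOpen_extChartAt_target x₀).mem_nhds hz)).differentiableAt (by simp)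
  have hd' : DifferentiableAt ℝ (fun w ↦ chartForm η x₀ w b) (φ (φ.symm z)) := by
    rw [φ.right_inv hz]
    exact hd.clm_apply (differentiableAt_const b)
  have hφd : MDifferentiableAt 𝓘(ℝ, E) 𝓘(ℝ, E) φ (φ.symm z) :=
    mdifferentiableAt_extChartAt (by simpa [hφ] using hy)
  have hev : (fun y ↦ η y (coordField x₀ b y)) =ᶠ[𝓝 (φ.symm z)]
      (fun w ↦ chartForm η x₀ w b) ∘ φ := by
    filter_upwards [(isOpen_extChartAt_source x₀).mem_nhds hy] with y hy'
    simp only [Function.comp, chartForm_apply]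
    rw [← hφ, φ.left_inv hy']
  have h1 : mvfderiv 𝓘(ℝ, E) (fun y ↦ η y (coordField x₀ b y)) (φ.symm z) =
      (fderiv ℝ (fun w ↦ chartForm η x₀ w b) (φ (φ.symm z))).comp
        (mfderiv 𝓘(ℝ, E) 𝓘(ℝ, E) φ (φ.symm z)) := by
    have := hd'.hasFDerivAt.hasMFDerivAt.comp (φ.symm z) hφd.hasMFDerivAt
    exact (this.congr_of_eventuallyEq hev).mfderiv
  rw [h1, φ.right_inv hz]
  have h2 := mfderiv_coordField hy a
  have h3 := fderiv_clm_apply hd (differentiableAt_const b)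
  change _ = fderiv ℝ (fun w ↦ chartForm η x₀ w b) z
    (mfderiv 𝓘(ℝ, E) 𝓘(ℝ, E) φ (φ.symm z) (coordField x₀ a (φ.symm z)))
  rw [h2, h3]
  simp

/-- Coordinate fields commute, so on them the bracket term of closedness drops out and what remains
is the symmetry required by the Poincaré lemma. -/
theorem fderiv_chartForm_symm [FiniteDimensional ℝ E] (hω : SmoothOneForm η)
    (hc : ClosedOneForm η) {x₀ : M} {z : E}
    (hz : z ∈ (extChartAt 𝓘(ℝ, E) x₀).target) (a b : E) :
    fderiv ℝ (chartForm η x₀) z a b = fderiv ℝ (chartForm η x₀) z b a := by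
  have := FiniteDimensional.complete ℝ E
  have hy := (extChartAt 𝓘(ℝ, E) x₀).map_target hz
  have h := hc _ _ _ (contMDiffAt_coordField hy a) (contMDiffAt_coordField hy b)
  rw [mlieBracket_coordField hy, map_zero] at h
  rw [fderiv_chartForm hω hz, fderiv_chartForm hω hz]
  exact sub_eq_zero.1 h

/-- A ball inside the chart's target is convex, so the Poincaré lemma applies there; composing with
the chart carries the primitive back to the manifold. -/
theorem exists_local_primitive [FiniteDimensional ℝ E] [CompleteSpace V] (hω : SmoothOneForm η)
    (hc : ClosedOneForm η) (x₀ : M) :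
    ∃ (U : Set M) (u : M → V), IsOpen U ∧ x₀ ∈ U ∧
      ∀ y ∈ U, HasMFDerivAt 𝓘(ℝ, E) 𝓘(ℝ, V) u y (η y) := by
  have ht : (extChartAt 𝓘(ℝ, E) x₀).target ∈ 𝓝 (extChartAt 𝓘(ℝ, E) x₀ x₀) :=
    extChartAt_target_mem_nhds x₀
  obtain ⟨r, hr, hB⟩ := Metric.mem_nhds_iff.1 ht
  obtain ⟨w, hw⟩ := (convex_ball (extChartAt 𝓘(ℝ, E) x₀ x₀) r).exists_forall_hasFDerivAt_of_fderiv_symmetric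
    Metric.isOpen_ball
    (((contDiffOn_chartForm hω x₀).mono hB).differentiableOn (by simp))
    (fun a ha x y ↦ fderiv_chartForm_symm hω hc (hB ha) x y)
  refine ⟨(extChartAt 𝓘(ℝ, E) x₀).source ∩
    extChartAt 𝓘(ℝ, E) x₀ ⁻¹' Metric.ball (extChartAt 𝓘(ℝ, E) x₀ x₀) r,
    w ∘ extChartAt 𝓘(ℝ, E) x₀,
    (continuousOn_extChartAt x₀).isOpen_inter_preimage (isOpen_extChartAt_source x₀)
      Metric.isOpen_ball, ⟨mem_extChartAt_source x₀, Metric.mem_ball_self hr⟩, ?_⟩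
  rintro y ⟨hy, hyB⟩
  have hφd : MDifferentiableAt 𝓘(ℝ, E) 𝓘(ℝ, E) (extChartAt 𝓘(ℝ, E) x₀) y :=
    mdifferentiableAt_extChartAt (by simpa using hy)
  have h := (hw _ hyB).hasMFDerivAt.comp y hφd.hasMFDerivAt
  exact (chartForm_comp_mfderiv (η := η) hy) ▸ h

theorem eventually_eq_of_hasMFDerivAt_zero {U : Set M} (hU : IsOpen U) {w : M → V}
    (hw : ∀ y ∈ U, HasMFDerivAt 𝓘(ℝ, E) 𝓘(ℝ, V) w y
      (0 : TangentSpace 𝓘(ℝ, E) y →L[ℝ] V)) {x : M} (hx : x ∈ U) :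
    ∀ᶠ y in 𝓝 x, w y = w x := by
  set φ := extChartAt 𝓘(ℝ, E) x with hφ
  have hxs : x ∈ φ.source := mem_extChartAt_source x
  have hO : IsOpen (φ.target ∩ φ.symm ⁻¹' U) :=
    (continuousOn_extChartAt_symm x).isOpen_inter_preimage (isOpen_extChartAt_target x) hU
  have hxO : φ x ∈ φ.target ∩ φ.symm ⁻¹' U :=
    ⟨φ.map_source hxs, by simpa [φ.left_inv hxs] using hx⟩
  obtain ⟨r, hr, hB⟩ := Metric.mem_nhds_iff.1 (hO.mem_nhds hxO)
  have hd : ∀ z ∈ Metric.ball (φ x) r, HasFDerivAt (w ∘ φ.symm) (0 : E →L[ℝ] V) z := by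
    intro z hz
    obtain ⟨hz1, hz2⟩ := hB hz
    have hs : MDifferentiableAt 𝓘(ℝ, E) 𝓘(ℝ, E) φ.symm z :=
      (((contMDiffOn_extChartAt_symm (n := 1) x) z hz1).contMDiffAt
        ((isOpen_extChartAt_target x).mem_nhds hz1)).mdifferentiableAt (by simp)
    have h := (hw _ hz2).comp z hs.hasMFDerivAt
    exact h.hasFDerivAt.congr_fderiv (ContinuousLinearMap.ext fun v ↦ rfl)
  have hconst : ∀ z ∈ Metric.ball (φ x) r, (w ∘ φ.symm) z = (w ∘ φ.symm) (φ x) := by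
    intro z hz
    refine (convex_ball (φ x) r).is_const_of_fderivWithin_eq_zero (𝕜 := ℝ)
      (fun y hy ↦ (hd y hy).differentiableAt.differentiableWithinAt) (fun y hy ↦ ?_) hz
      (Metric.mem_ball_self hr)
    rw [fderivWithin_of_isOpen Metric.isOpen_ball hy, (hd y hy).fderiv]
  have hc : ContinuousAt φ x := continuousAt_extChartAt x
  filter_upwards [hc.preimage_mem_nhds (Metric.ball_mem_nhds _ hr),
    (isOpen_extChartAt_source x).mem_nhds hxs] with y hy hys
  have := hconst _ hy
  simp only [Function.comp] at this
  rwa [φ.left_inv hys, φ.left_inv hxs] at this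

/-- On a simply connected manifold, a closed smooth one-form is exact. -/
theorem exists_primitive [FiniteDimensional ℝ E] [CompleteSpace V] [SimplyConnectedSpace M]
    (hω : SmoothOneForm η) (hc : ClosedOneForm η) :
    ∃ F : M → V, ∀ x, HasMFDerivAt 𝓘(ℝ, E) 𝓘(ℝ, V) F x (η x) := by
  have : LocallyPathConnectedSpace M := ChartedSpace.locallyPathConnectedSpace E M
  choose U u hU hmem hu using exists_local_primitive hω hc
  -- Two local primitives have the same differential on their overlap, so their difference is
  -- locally constant.
  obtain ⟨F, hF⟩ := exists_global_of_locally_constant_sub U hU hmem u fun i j x hx ↦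
    eventually_eq_of_hasMFDerivAt_zero ((hU i).inter (hU j)) (w := fun y ↦ u i y - u j y)
      (fun y hy ↦ by
        exact ((hu i y hy.1).sub (hu j y hy.2)).of_eq (sub_self (η y))) hx
  refine ⟨F, fun x ↦ ?_⟩
  have h1 : HasMFDerivAt 𝓘(ℝ, E) 𝓘(ℝ, V) (fun _ : M ↦ F x - u x x) x 0 :=
    hasMFDerivAt_const _ _
  have h2 := (hu x x (hmem x)).add h1
  refine (h2.of_eq (add_zero (η x))).congr_of_eventuallyEq ?_
  filter_upwards [hF x] with y hy
  simp only [Pi.add_apply]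
  rw [← hy]
  abel

/-- In a chart the derivative of F is `chartForm`, which is already known to be smooth. -/
theorem contMDiff_of_hasMFDerivAt [FiniteDimensional ℝ E] (hω : SmoothOneForm η) {F : M → V}
    (hF : ∀ x, HasMFDerivAt 𝓘(ℝ, E) 𝓘(ℝ, V) F x (η x)) :
    ContMDiff 𝓘(ℝ, E) 𝓘(ℝ, V) ∞ F := by
  intro x
  set φ := extChartAt 𝓘(ℝ, E) x with hφ
  have hopen : IsOpen φ.target := isOpen_extChartAt_target x
  have hd : ∀ z ∈ φ.target, HasFDerivAt (F ∘ φ.symm) (chartForm η x z) z := by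
    intro z hz
    have hs : MDifferentiableAt 𝓘(ℝ, E) 𝓘(ℝ, E) φ.symm z :=
      (((contMDiffOn_extChartAt_symm (n := 1) x) z hz).contMDiffAt
        (hopen.mem_nhds hz)).mdifferentiableAt (by simp)
    have h := ((hF _).comp z hs.hasMFDerivAt).hasFDerivAt
    refine h.congr_fderiv (ContinuousLinearMap.ext fun b ↦ ?_)
    have hy := φ.map_target hz
    have hi := mfderiv_extChartAt_comp_mfderivWithin_extChartAt_symm (I := 𝓘(ℝ, E)) hz
    rw [modelWithCornersSelf_coe, range_id, mfderivWithin_univ] at hi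
    have hb := DFunLike.congr_fun hi b
    have hinv : (mfderiv 𝓘(ℝ, E) 𝓘(ℝ, E) φ (φ.symm z)).inverse b =
        mfderiv 𝓘(ℝ, E) 𝓘(ℝ, E) φ.symm z b :=
      (isInvertible_mfderiv_extChartAt hy).inverse_apply_eq.2 hb.symm
    exact (congrArg (η (φ.symm z)) hinv).symm
  have hsm : ContDiffOn ℝ ∞ (F ∘ φ.symm) φ.target := by
    rw [contDiffOn_infty_iff_fderiv_of_isOpen hopen]
    refine ⟨fun z hz ↦ (hd z hz).differentiableAt.differentiableWithinAt, ?_⟩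
    exact (contDiffOn_chartForm hω x).congr fun z hz ↦ (hd z hz).fderiv
  rw [contMDiffAt_iff_source]
  exact (hsm.contDiffAt (hopen.mem_nhds (mem_extChartAt_target x))).contMDiffAt.contMDiffWithinAt

end OneForms

/-! ### Symmetry of second derivatives, in terms of vector fields -/

section SecondDerivative

variable {E : Type*} [NormedAddCommGroup E] [NormedSpace ℝ E]
  {M : Type*} [TopologicalSpace M] [ChartedSpace E M] [IsManifold 𝓘(ℝ, E) ∞ M]
  {V : Type*} [NormedAddCommGroup V] [NormedSpace ℝ V]

/-- The vector field `X` written in the chart at `x`. -/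
def chartField (x : M) (X : Π x : M, TangentSpace 𝓘(ℝ, E) x) (z : E) : E :=
  mpullbackWithin 𝓘(ℝ, E) 𝓘(ℝ, E) (extChartAt 𝓘(ℝ, E) x).symm X (range 𝓘(ℝ, E)) z

theorem differentiableAt_chartField [CompleteSpace E] {x : M}
    {X : Π x : M, TangentSpace 𝓘(ℝ, E) x}
    (hX : MDifferentiableAt 𝓘(ℝ, E) 𝓘(ℝ, E).tangent
      (fun y : M ↦ TotalSpace.mk' E (E := fun y : M ↦ TangentSpace 𝓘(ℝ, E) y) y (X y)) x) :
    DifferentiableAt ℝ (chartField x X) (extChartAt 𝓘(ℝ, E) x x) := by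
  have : IsManifold 𝓘(ℝ, E) 2 M := IsManifold.of_le (n := ∞) ENat.LEInfty.out
  have h := (mdifferentiableWithinAt_univ.2 hX).differentiableWithinAt_mpullbackWithin_vectorField
  have hu : (extChartAt 𝓘(ℝ, E) x).symm ⁻¹' univ ∩ range 𝓘(ℝ, E) = univ := by simp
  rw [hu] at h
  exact differentiableWithinAt_univ.1 h

theorem mvfderiv_symm_comp_chartField {f : M → V} (hf : ContMDiff 𝓘(ℝ, E) 𝓘(ℝ, V) ∞ f) {x : M}
    {z : E} (hz : z ∈ (extChartAt 𝓘(ℝ, E) x).target) (X : Π x : M, TangentSpace 𝓘(ℝ, E) x) :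
    fderiv ℝ (f ∘ (extChartAt 𝓘(ℝ, E) x).symm) z (chartField x X z) =
      mvfderiv 𝓘(ℝ, E) f ((extChartAt 𝓘(ℝ, E) x).symm z) (X ((extChartAt 𝓘(ℝ, E) x).symm z)) := by
  have hs : MDifferentiableAt 𝓘(ℝ, E) 𝓘(ℝ, E) (extChartAt 𝓘(ℝ, E) x).symm z :=
    (((contMDiffOn_extChartAt_symm (n := 1) x) z hz).contMDiffAt
      ((isOpen_extChartAt_target x).mem_nhds hz)).mdifferentiableAt (by simp)
  have hfd : MDifferentiableAt 𝓘(ℝ, E) 𝓘(ℝ, V) f ((extChartAt 𝓘(ℝ, E) x).symm z) :=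
    (hf _).mdifferentiableAt (by simp)
  have h0 : mfderiv 𝓘(ℝ, E) 𝓘(ℝ, V) (f ∘ (extChartAt 𝓘(ℝ, E) x).symm) z =
    fderiv ℝ (f ∘ (extChartAt 𝓘(ℝ, E) x).symm) z := mfderiv_eq_fderiv
  have h : ∀ v : E, fderiv ℝ (f ∘ (extChartAt 𝓘(ℝ, E) x).symm) z v =
      mvfderiv 𝓘(ℝ, E) f ((extChartAt 𝓘(ℝ, E) x).symm z)
        (mfderiv 𝓘(ℝ, E) 𝓘(ℝ, E) (extChartAt 𝓘(ℝ, E) x).symm z v) := fun v ↦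
    (congrArg (fun L : E →L[ℝ] V ↦ L v) h0.symm).trans (mfderiv_comp_apply z hfd hs v)
  have hi := (isInvertible_mfderivWithin_extChartAt_symm (I := 𝓘(ℝ, E)) hz).self_apply_inverse
    (X ((extChartAt 𝓘(ℝ, E) x).symm z))
  have hu : mfderivWithin 𝓘(ℝ, E) 𝓘(ℝ, E) (extChartAt 𝓘(ℝ, E) x).symm (range 𝓘(ℝ, E)) z =
    mfderiv 𝓘(ℝ, E) 𝓘(ℝ, E) (extChartAt 𝓘(ℝ, E) x).symm z := by
    rw [modelWithCornersSelf_coe, range_id, mfderivWithin_univ]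
  rw [h]
  refine congrArg (mvfderiv 𝓘(ℝ, E) f ((extChartAt 𝓘(ℝ, E) x).symm z)) ?_
  rw [← hu]
  exact hi

theorem mvfderiv_of_comp_symm {g : M → V} {x : M}
    (hg : DifferentiableAt ℝ (g ∘ (extChartAt 𝓘(ℝ, E) x).symm) (extChartAt 𝓘(ℝ, E) x x))
    (v : TangentSpace 𝓘(ℝ, E) x) :
    mvfderiv 𝓘(ℝ, E) g x v =
      fderiv ℝ (g ∘ (extChartAt 𝓘(ℝ, E) x).symm) (extChartAt 𝓘(ℝ, E) x x) v := by
  have hφd : MDifferentiableAt 𝓘(ℝ, E) 𝓘(ℝ, E) (extChartAt 𝓘(ℝ, E) x) x :=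
    mdifferentiableAt_extChartAt (by simp)
  have h := hg.hasFDerivAt.hasMFDerivAt.comp x hφd.hasMFDerivAt
  have hev : g =ᶠ[𝓝 x] (g ∘ (extChartAt 𝓘(ℝ, E) x).symm) ∘ extChartAt 𝓘(ℝ, E) x := by
    filter_upwards [(isOpen_extChartAt_source x).mem_nhds (mem_extChartAt_source (I := 𝓘(ℝ, E)) x)]
      with y hy
    simp only [Function.comp]
    rw [(extChartAt 𝓘(ℝ, E) x).left_inv hy]
  have h' := (h.congr_of_eventuallyEq hev).mfderiv
  have h2 : mvfderiv 𝓘(ℝ, E) g x v =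
      fderiv ℝ (g ∘ (extChartAt 𝓘(ℝ, E) x).symm) (extChartAt 𝓘(ℝ, E) x x)
        (mfderiv 𝓘(ℝ, E) 𝓘(ℝ, E) (extChartAt 𝓘(ℝ, E) x) x v) :=
    DFunLike.congr_fun h' v
  rw [h2, mfderiv_extChartAt_self]
  rfl

theorem contDiffAt_comp_extChartAt_symm {f : M → V} (hf : ContMDiff 𝓘(ℝ, E) 𝓘(ℝ, V) ∞ f) (x : M) :
    ContDiffAt ℝ ∞ (f ∘ (extChartAt 𝓘(ℝ, E) x).symm) (extChartAt 𝓘(ℝ, E) x x) := by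
  have h2 : ContMDiffAt 𝓘(ℝ, E) 𝓘(ℝ, E) ∞ (extChartAt 𝓘(ℝ, E) x).symm (extChartAt 𝓘(ℝ, E) x x) :=
    ((contMDiffOn_extChartAt_symm x) _ (mem_extChartAt_target x)).contMDiffAt
      (extChartAt_target_mem_nhds x)
  exact ((hf _).comp _ h2).contDiffAt

/-- The product rule in the chart: one term differentiates the field, the other is the second
derivative of f. Differentiability of X at the single point suffices. -/
theorem hasFDerivAt_mvfderiv_field [CompleteSpace E] {f : M → V}
    (hf : ContMDiff 𝓘(ℝ, E) 𝓘(ℝ, V) ∞ f) {x : M} {X : Π x : M, TangentSpace 𝓘(ℝ, E) x}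
    (hX : MDifferentiableAt 𝓘(ℝ, E) 𝓘(ℝ, E).tangent
      (fun y : M ↦ TotalSpace.mk' E (E := fun y : M ↦ TangentSpace 𝓘(ℝ, E) y) y (X y)) x) :
    HasFDerivAt ((fun y ↦ mvfderiv 𝓘(ℝ, E) f y (X y)) ∘ (extChartAt 𝓘(ℝ, E) x).symm)
      ((fderiv ℝ (f ∘ (extChartAt 𝓘(ℝ, E) x).symm) (extChartAt 𝓘(ℝ, E) x x)).comp
        (fderiv ℝ (chartField x X) (extChartAt 𝓘(ℝ, E) x x)) +
        (fderiv ℝ (fderiv ℝ (f ∘ (extChartAt 𝓘(ℝ, E) x).symm)) (extChartAt 𝓘(ℝ, E) x x)).flip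
          (chartField x X (extChartAt 𝓘(ℝ, E) x x))) (extChartAt 𝓘(ℝ, E) x x) := by
  have h1 := (contDiffAt_comp_extChartAt_symm hf x).fderiv_right (m := 1) (by norm_cast)
  have h2 := (h1.differentiableAt (by simp)).hasFDerivAt.clm_apply
    (differentiableAt_chartField hX).hasFDerivAt
  refine h2.congr_of_eventuallyEq ?_
  filter_upwards [extChartAt_target_mem_nhds (I := 𝓘(ℝ, E)) x] with z hz
  exact (mvfderiv_symm_comp_chartField hf hz X).symm

theorem mdifferentiableAt_mvfderiv_field [CompleteSpace E] {f : M → V}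
    (hf : ContMDiff 𝓘(ℝ, E) 𝓘(ℝ, V) ∞ f) {x : M} {X : Π x : M, TangentSpace 𝓘(ℝ, E) x}
    (hX : MDifferentiableAt 𝓘(ℝ, E) 𝓘(ℝ, E).tangent
      (fun y : M ↦ TotalSpace.mk' E (E := fun y : M ↦ TangentSpace 𝓘(ℝ, E) y) y (X y)) x) :
    MDifferentiableAt 𝓘(ℝ, E) 𝓘(ℝ, V) (fun y ↦ mvfderiv 𝓘(ℝ, E) f y (X y)) x := by
  rw [mdifferentiableAt_iff_source_of_mem_source (mem_chart_source E x)]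
  exact (hasFDerivAt_mvfderiv_field hf hX).differentiableAt.mdifferentiableAt.mdifferentiableWithinAt

theorem chartField_self (x : M) (X : Π x : M, TangentSpace 𝓘(ℝ, E) x) :
    chartField x X (extChartAt 𝓘(ℝ, E) x x) = X x := by
  have h := mfderivWithin_range_extChartAt_symm (I := 𝓘(ℝ, E)) (x := x)
  have h1 := (isInvertible_mfderivWithin_extChartAt_symm (I := 𝓘(ℝ, E))
    (mem_extChartAt_target x)).self_apply_inverse
      (X ((extChartAt 𝓘(ℝ, E) x).symm (extChartAt 𝓘(ℝ, E) x x)))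
  have h2 := congrArg (fun L : E →L[ℝ] E ↦ L (chartField x X (extChartAt 𝓘(ℝ, E) x x))) h
  have h3 : ∀ y, y = x → (X y : E) = X x := fun y hy ↦ by rw [hy]
  exact h2.symm.trans (h1.trans (h3 _ ((extChartAt 𝓘(ℝ, E) x).left_inv (mem_extChartAt_source x))))

/-- The differential of a smooth function is closed: `X (df Y) - Y (df X) = df [X, Y]`. -/
theorem mvfderiv_mvfderiv_sub [CompleteSpace E] {f : M → V}
    (hf : ContMDiff 𝓘(ℝ, E) 𝓘(ℝ, V) ∞ f) {x : M} {X Y : Π x : M, TangentSpace 𝓘(ℝ, E) x}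
    (hX : MDifferentiableAt 𝓘(ℝ, E) 𝓘(ℝ, E).tangent
      (fun y : M ↦ TotalSpace.mk' E (E := fun y : M ↦ TangentSpace 𝓘(ℝ, E) y) y (X y)) x)
    (hY : MDifferentiableAt 𝓘(ℝ, E) 𝓘(ℝ, E).tangent
      (fun y : M ↦ TotalSpace.mk' E (E := fun y : M ↦ TangentSpace 𝓘(ℝ, E) y) y (Y y)) x) :
    mvfderiv 𝓘(ℝ, E) (fun y ↦ mvfderiv 𝓘(ℝ, E) f y (Y y)) x (X x) -
      mvfderiv 𝓘(ℝ, E) (fun y ↦ mvfderiv 𝓘(ℝ, E) f y (X y)) x (Y x) =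
      mvfderiv 𝓘(ℝ, E) f x (mlieBracket 𝓘(ℝ, E) X Y x) := by
  have hX' := hasFDerivAt_mvfderiv_field hf hX
  have hY' := hasFDerivAt_mvfderiv_field hf hY
  have hf' := contDiffAt_comp_extChartAt_symm hf x
  have hbr : mlieBracket 𝓘(ℝ, E) X Y x = lieBracket ℝ (chartField x X) (chartField x Y)
      (extChartAt 𝓘(ℝ, E) x x) := by
    have hu : (extChartAt 𝓘(ℝ, E) x).symm ⁻¹' univ ∩ range 𝓘(ℝ, E) = univ := by simp
    have h1 : mlieBracket 𝓘(ℝ, E) X Y x = ContinuousLinearMap.inverse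
        (mfderiv 𝓘(ℝ, E) 𝓘(ℝ, E) (extChartAt 𝓘(ℝ, E) x) x)
        (lieBracketWithin ℝ (chartField x X) (chartField x Y)
          ((extChartAt 𝓘(ℝ, E) x).symm ⁻¹' univ ∩ range 𝓘(ℝ, E)) (extChartAt 𝓘(ℝ, E) x x) : E) :=
      rfl
    rw [h1, hu, lieBracketWithin_univ, mfderiv_extChartAt_self]
    have h2 : ∀ v : E, ContinuousLinearMap.inverse (ContinuousLinearMap.id ℝ E) v = v := by simp
    exact h2 _
  have hsymm := (hf'.isSymmSndFDerivAt (by simpa using ENat.LEInfty.out)).eq (X x) (Y x)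
  rw [mvfderiv_of_comp_symm hX'.differentiableAt, mvfderiv_of_comp_symm hY'.differentiableAt,
    mvfderiv_of_comp_symm (hf'.differentiableAt (by simp)), hX'.fderiv, hY'.fderiv, hbr,
    chartField_self, chartField_self]
  -- The second-derivative terms cancel by symmetry, leaving the first derivative of f on the chart
  -- expression of the bracket.
  have key : ∀ (D : E →L[ℝ] V) (D₂ : E →L[ℝ] E →L[ℝ] V) (P Q : E →L[ℝ] E) (a b : E),
      D₂ a b = D₂ b a →
      (D.comp Q + D₂.flip b) a - (D.comp P + D₂.flip a) b = D (Q a - P b) := by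
    intro D D₂ P Q a b h
    simp [h]
  refine (key _ _ _ _ _ _ hsymm).trans ?_
  rw [lieBracket, chartField_self, chartField_self]

end SecondDerivative

/-! ### Smoothness criteria for tensor fields, and the metric ⟨Q²·,·⟩ -/

section SmoothFields

/-- In a finite basis, L is a finite sum of fixed coordinate functionals times the smooth values of
L on basis vectors. -/
theorem contMDiffAt_clm_of_apply {E : Type*} [NormedAddCommGroup E] [NormedSpace ℝ E]
    {M : Type*} [TopologicalSpace M] [ChartedSpace E M]
    {F : Type*} [NormedAddCommGroup F] [NormedSpace ℝ F] [FiniteDimensional ℝ F]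
    {V : Type*} [NormedAddCommGroup V] [NormedSpace ℝ V] {L : M → F →L[ℝ] V} {x : M}
    (h : ∀ v, ContMDiffAt 𝓘(ℝ, E) 𝓘(ℝ, V) ∞ (fun y ↦ L y v) x) :
    ContMDiffAt 𝓘(ℝ, E) 𝓘(ℝ, F →L[ℝ] V) ∞ L x := by
  let b := Module.finBasis ℝ F
  let c : Fin (Module.finrank ℝ F) → F →L[ℝ] ℝ := fun i ↦ LinearMap.toContinuousLinearMap (b.coord i)
  have hL : L = fun y ↦ ∑ i, ContinuousLinearMap.smulRightL ℝ F V (c i) (L y (b i)) := by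
    ext y v
    conv_lhs => rw [← b.sum_repr v, map_sum]
    simp [c]
  rw [hL]
  refine contMDiffAt_finsetSum fun i _ ↦ ?_
  exact (ContinuousLinearMap.smulRightL ℝ F V (c i)).contMDiff.contMDiffAt.comp x (h (b i))

theorem contMDiffAt_mvfderiv_field {E : Type*} [NormedAddCommGroup E] [NormedSpace ℝ E]
    {M : Type*} [TopologicalSpace M] [ChartedSpace E M] [IsManifold 𝓘(ℝ, E) ∞ M]
    {V : Type*} [NormedAddCommGroup V] [NormedSpace ℝ V] {f : M → V}
    (hf : ContMDiff 𝓘(ℝ, E) 𝓘(ℝ, V) ∞ f) {x : M} {X : Π x : M, TangentSpace 𝓘(ℝ, E) x}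
    (hX : ContMDiffAt 𝓘(ℝ, E) 𝓘(ℝ, E).tangent ∞
      (fun y : M ↦ TotalSpace.mk' E (E := fun y : M ↦ TangentSpace 𝓘(ℝ, E) y) y (X y)) x) :
    ContMDiffAt 𝓘(ℝ, E) 𝓘(ℝ, V) ∞ (fun y ↦ mvfderiv 𝓘(ℝ, E) f y (X y)) x := by
  have h1 : ContMDiff 𝓘(ℝ, E).tangent 𝓘(ℝ, V).tangent ∞ (tangentMap 𝓘(ℝ, E) 𝓘(ℝ, V) f) :=
    hf.contMDiff_tangentMap (by simp)
  exact (contMDiff_snd_tangentBundle_modelSpace V 𝓘(ℝ, V)).contMDiffAt.comp x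
    (h1.contMDiffAt.comp x hX)

variable {n : ℕ} {M : Type*} [TopologicalSpace M]
  [ChartedSpace (EuclideanSpace ℝ (Fin n)) M] [IsManifold (𝓡 n) ∞ M]

/-- The local vector field with constant value `b` in the trivialization of the tangent bundle
at `x`. -/
def frameField (x : M) (b : EuclideanSpace ℝ (Fin n)) : VField n M := fun y ↦
  (trivializationAt (EuclideanSpace ℝ (Fin n)) (TangentSpace (𝓡 n)) x).symmL ℝ y b

theorem smoothFieldAt_frameField (x : M) (b : EuclideanSpace ℝ (Fin n)) :
    SmoothFieldAt (frameField x b) x := by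
  refine (contMDiffAt_section x).2 ?_
  refine (contMDiffAt_const (c := b)).congr_of_eventuallyEq ?_
  have hx := mem_baseSet_trivializationAt (EuclideanSpace ℝ (Fin n)) (TangentSpace (𝓡 n)) x
  filter_upwards [(trivializationAt (EuclideanSpace ℝ (Fin n))
    (TangentSpace (𝓡 n)) x).open_baseSet.mem_nhds hx] with y hy
  rw [frameField, Trivialization.symmL_apply _ hy]
  exact congrArg Prod.snd (Trivialization.apply_mk_symm _ hy b)

theorem exists_smoothFieldAt (x : M) (v : TangentSpace (𝓡 n) x) :
    ∃ X : VField n M, SmoothFieldAt X x ∧ X x = v :=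
  ⟨FiberBundle.extend (EuclideanSpace ℝ (Fin n)) v, FiberBundle.contMDiffAt_extend ..,
    FiberBundle.extend_apply_self ..⟩

theorem EndoField.Smooth.apply {Q : EndoField n M} (hQ : Q.Smooth) {X : VField n M} {x : M}
    (hX : SmoothFieldAt X x) : SmoothFieldAt (fun y ↦ Q y (X y)) x :=
  (hQ x).clm_bundle_apply hX

theorem contMDiffAt_inner (m : Metric n M) {x : M} {X Y : VField n M}
    (hX : SmoothFieldAt X x) (hY : SmoothFieldAt Y x) :
    ContMDiffAt (𝓡 n) 𝓘(ℝ, ℝ) ∞ (fun y ↦ m.inner y (X y) (Y y)) x := by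
  let _ : RiemannianBundle (fun x : M ↦ TangentSpace (𝓡 n) x) := ⟨m.toRiemannianMetric⟩
  exact ContMDiffAt.inner_bundle (F := EuclideanSpace ℝ (Fin n)) hX hY

/-- A field of bilinear forms is smooth if it maps smooth vector fields to smooth functions. -/
theorem contMDiffAt_bilin {x : M}
    (B : Π x : M, TangentSpace (𝓡 n) x →L[ℝ] TangentSpace (𝓡 n) x →L[ℝ] ℝ)
    (h : ∀ X Y : VField n M, SmoothFieldAt X x → SmoothFieldAt Y x →
      ContMDiffAt (𝓡 n) 𝓘(ℝ, ℝ) ∞ (fun y ↦ B y (X y) (Y y)) x) :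
    ContMDiffAt (𝓡 n) ((𝓡 n).prod 𝓘(ℝ, EuclideanSpace ℝ (Fin n) →L[ℝ]
      EuclideanSpace ℝ (Fin n) →L[ℝ] ℝ)) ∞
      (fun y ↦ TotalSpace.mk' (EuclideanSpace ℝ (Fin n) →L[ℝ] EuclideanSpace ℝ (Fin n) →L[ℝ] ℝ)
        (E := fun x : M ↦ TangentSpace (𝓡 n) x →L[ℝ] TangentSpace (𝓡 n) x →L[ℝ] ℝ) y (B y)) x := by
  rw [contMDiffAt_hom_bundle]
  refine ⟨contMDiffAt_id, ?_⟩
  refine contMDiffAt_clm_of_apply fun a ↦ contMDiffAt_clm_of_apply fun b ↦ ?_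
  refine (h _ _ (smoothFieldAt_frameField x a) (smoothFieldAt_frameField x b)).congr_of_eventuallyEq ?_
  have hx := mem_baseSet_trivializationAt (EuclideanSpace ℝ (Fin n)) (TangentSpace (𝓡 n)) x
  filter_upwards [(trivializationAt (EuclideanSpace ℝ (Fin n))
    (TangentSpace (𝓡 n)) x).open_baseSet.mem_nhds hx] with y hy
  have h2 := inCoordinates_apply_eq₂ (F₁ := EuclideanSpace ℝ (Fin n))
    (F₂ := EuclideanSpace ℝ (Fin n)) (F₃ := ℝ) (E₁ := TangentSpace (M := M) (𝓡 n))
    (E₂ := TangentSpace (M := M) (𝓡 n)) (E₃ := Bundle.Trivial M ℝ) (x₀ := x) (ϕ := B y)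
    (v := a) (w := b) hy hy (mem_univ _)
  refine h2.trans ?_
  rw [frameField, frameField, Trivialization.symmL_apply _ hy, Trivialization.symmL_apply _ hy]
  simp

/-- A vector field is smooth if its products with smooth vector fields are smooth. -/
theorem smoothFieldAt_of_inner (m : Metric n M) {x : M} {W : VField n M}
    (h : ∀ Z : VField n M, SmoothFieldAt Z x →
      ContMDiffAt (𝓡 n) 𝓘(ℝ, ℝ) ∞ (fun y ↦ m.inner y (W y) (Z y)) x) :
    SmoothFieldAt W x := by
  let e := trivializationAt (EuclideanSpace ℝ (Fin n)) (TangentSpace (M := M) (𝓡 n)) x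
  -- In the trivialization, G is the Gram form of the metric, c the covector ⟨W,·⟩ and w the
  -- coordinates of W. Then w = G⁻¹c, and inversion of operators is smooth at an invertible one.
  let G : M → EuclideanSpace ℝ (Fin n) →L[ℝ] EuclideanSpace ℝ (Fin n) →L[ℝ] ℝ := fun y ↦
    ((e.symmL ℝ y).precomp ℝ).comp ((m.inner y).comp (e.symmL ℝ y))
  let c : M → EuclideanSpace ℝ (Fin n) →L[ℝ] ℝ := fun y ↦ (m.inner y (W y)).comp (e.symmL ℝ y)
  let w : M → EuclideanSpace ℝ (Fin n) := fun y ↦ (e ⟨y, W y⟩).2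
  have hx : x ∈ e.baseSet := mem_baseSet_trivializationAt _ _ x
  have hG : ContMDiffAt (𝓡 n) 𝓘(ℝ, EuclideanSpace ℝ (Fin n) →L[ℝ]
      EuclideanSpace ℝ (Fin n) →L[ℝ] ℝ) ∞ G x :=
    contMDiffAt_clm_of_apply fun a ↦ contMDiffAt_clm_of_apply fun b ↦
      contMDiffAt_inner m (smoothFieldAt_frameField x a) (smoothFieldAt_frameField x b)
  have hc : ContMDiffAt (𝓡 n) 𝓘(ℝ, EuclideanSpace ℝ (Fin n) →L[ℝ] ℝ) ∞ c x :=
    contMDiffAt_clm_of_apply fun b ↦ h _ (smoothFieldAt_frameField x b)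
  have hinj : ∀ y ∈ e.baseSet, Function.Injective (G y) := by
    intro y hy
    rw [injective_iff_map_eq_zero]
    intro a ha
    by_contra hne
    have h0 : e.symmL ℝ y a ≠ 0 := by
      intro h0
      apply hne
      have := e.continuousLinearMapAt_symmL (R := ℝ) hy a
      rw [h0, map_zero] at this
      exact this.symm
    have h1 := m.pos y _ h0
    have h2 := DFunLike.congr_fun ha a
    exact h1.ne' h2
  have hrank : Module.finrank ℝ (EuclideanSpace ℝ (Fin n)) =
      Module.finrank ℝ (EuclideanSpace ℝ (Fin n) →L[ℝ] ℝ) := by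
    rw [← (LinearMap.toContinuousLinearMap (𝕜 := ℝ) (E := EuclideanSpace ℝ (Fin n))
      (F' := ℝ)).finrank_eq]
    exact Subspace.dual_finrank_eq.symm
  let eq : ∀ y ∈ e.baseSet, EuclideanSpace ℝ (Fin n) ≃L[ℝ] (EuclideanSpace ℝ (Fin n) →L[ℝ] ℝ) :=
    fun y hy ↦ (LinearEquiv.ofInjectiveOfFinrankEq (G y : EuclideanSpace ℝ (Fin n) →ₗ[ℝ]
      (EuclideanSpace ℝ (Fin n) →L[ℝ] ℝ)) (hinj y hy) hrank).toContinuousLinearEquiv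
  have heq : ∀ y hy, (eq y hy : EuclideanSpace ℝ (Fin n) →L[ℝ] _) = G y := by
    intro y hy
    ext a b
    rfl
  have hw : ∀ y ∈ e.baseSet, w y = (G y).inverse (c y) := by
    intro y hy
    rw [← heq y hy, ContinuousLinearMap.inverse_equiv]
    rw [ContinuousLinearEquiv.coe_coe, ContinuousLinearEquiv.eq_symm_apply]
    change G y (w y) = c y
    ext b
    change m.inner y (e.symmL ℝ y (w y)) (e.symmL ℝ y b) = m.inner y (W y) (e.symmL ℝ y b)
    congr 2
    exact (e.symmL_apply hy _).trans (e.symm_apply_apply_mk hy (W y))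
  refine (contMDiffAt_section x).2 ?_
  have hinv : ContMDiffAt (𝓡 n) 𝓘(ℝ, (EuclideanSpace ℝ (Fin n) →L[ℝ] ℝ) →L[ℝ]
      EuclideanSpace ℝ (Fin n)) ∞ (fun y ↦ (G y).inverse) x := by
    have h1 : ContDiffAt ℝ ∞ ContinuousLinearMap.inverse (G x) := by
      rw [← heq x hx]
      exact contDiffAt_map_inverse _
    exact h1.contMDiffAt.comp x hG
  refine (hinv.clm_apply hc).congr_of_eventuallyEq ?_
  filter_upwards [e.open_baseSet.mem_nhds hx] with y hy
  exact hw y hy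

theorem smoothFieldAt_grad (m : Metric n M) {φ : M → ℝ} (hφ : ContMDiff (𝓡 n) 𝓘(ℝ, ℝ) ∞ φ)
    (x : M) : SmoothFieldAt (grad m φ) x := by
  refine smoothFieldAt_of_inner m fun Z hZ ↦ ?_
  have h : (fun y ↦ m.inner y (grad m φ y) (Z y)) = fun y ↦ mvfderiv (𝓡 n) φ y (Z y) :=
    funext fun y ↦ inner_sharp m y _ _
  rw [h]
  exact contMDiffAt_mvfderiv_field hφ hZ

/-- The metric `⟨Q², ·⟩` of an invertible self-adjoint tensor `Q`. -/
def squareMetric (m : Metric n M) (Q : EndoField n M) (hQ : Q.Smooth)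
    (hsa : ∀ (x : M) (u v : TangentSpace (𝓡 n) x), m.inner x (Q x u) v = m.inner x u (Q x v))
    (hns : ∀ x, Function.Bijective (Q x)) : Metric n M where
  inner x := (m.inner x).comp ((Q x).comp (Q x))
  symm x u v := by
    change m.inner x (Q x (Q x u)) v = m.inner x (Q x (Q x v)) u
    rw [hsa, hsa, m.symm]
  pos x v hv := by
    change 0 < m.inner x (Q x (Q x v)) v
    rw [hsa]
    exact m.pos x _ fun h ↦ hv ((hns x).1 (h.trans (map_zero _).symm))
  isVonNBounded x := by
    let e := (LinearEquiv.ofBijective (Q x : TangentSpace (𝓡 n) x →ₗ[ℝ] TangentSpace (𝓡 n) x)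
      (hns x)).toContinuousLinearEquiv
    -- Since ⟨Q²v,v⟩ = ⟨Qv,Qv⟩, the new unit ball lies in the image of the old one under Q⁻¹.
    refine ((m.isVonNBounded x).image (e.symm : TangentSpace (𝓡 n) x →L[ℝ] _)).subset ?_
    intro v hv
    refine ⟨e v, ?_, e.symm_apply_apply v⟩
    change m.inner x (Q x (Q x v)) v < 1 at hv
    rw [hsa] at hv
    exact hv
  contMDiff x := contMDiffAt_bilin (fun y ↦ (m.inner y).comp ((Q y).comp (Q y)))
    fun _ _ hX hY ↦ contMDiffAt_inner m (hQ.apply (hQ.apply hX)) hY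

end SmoothFields

/-! ### Gauss and Weingarten formulas -/

section Hypersurface

theorem mvfderiv_inner_apply {E : Type*} [NormedAddCommGroup E] [NormedSpace ℝ E]
    {M : Type*} [TopologicalSpace M] [ChartedSpace E M]
    {V : Type*} [NormedAddCommGroup V] [InnerProductSpace ℝ V] {a b : M → V} {x : M}
    (ha : MDifferentiableAt 𝓘(ℝ, E) 𝓘(ℝ, V) a x) (hb : MDifferentiableAt 𝓘(ℝ, E) 𝓘(ℝ, V) b x)
    (v : TangentSpace 𝓘(ℝ, E) x) :
    mvfderiv 𝓘(ℝ, E) (fun y ↦ inner ℝ (a y) (b y)) x v =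
      inner ℝ (mvfderiv 𝓘(ℝ, E) a x v) (b x) + inner ℝ (a x) (mvfderiv 𝓘(ℝ, E) b x v) := by
  have h : HasMFDerivAt 𝓘(ℝ, E) 𝓘(ℝ, ℝ) (fun y ↦ inner ℝ (a y) (b y)) x
      ((fderivInnerCLM ℝ (a x, b x)).comp
        ((mvfderiv 𝓘(ℝ, E) a x).prod (mvfderiv 𝓘(ℝ, E) b x)) : TangentSpace 𝓘(ℝ, E) x →L[ℝ] ℝ) := by
    have h1 : HasMFDerivAt 𝓘(ℝ, E) 𝓘(ℝ, V × V) (fun y ↦ (a y, b y)) x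
        ((mvfderiv 𝓘(ℝ, E) a x).prod (mvfderiv 𝓘(ℝ, E) b x)) :=
      ⟨ha.continuousAt.prodMk hb.continuousAt,
        ha.hasMFDerivAt.2.prodMk hb.hasMFDerivAt.2⟩
    have h2 : HasFDerivAt (fun p : V × V ↦ inner ℝ p.1 p.2) (fderivInnerCLM ℝ (a x, b x))
        (a x, b x) := isBoundedBilinearMap_inner.hasFDerivAt _
    exact HasMFDerivAt.comp x h2.hasMFDerivAt h1
  have h2 : mvfderiv 𝓘(ℝ, E) (fun y ↦ inner ℝ (a y) (b y)) x v = (fderivInnerCLM ℝ (a x, b x)).comp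
        ((mvfderiv 𝓘(ℝ, E) a x).prod (mvfderiv 𝓘(ℝ, E) b x)) v := DFunLike.congr_fun h.mfderiv v
  rw [h2]
  simp [fderivInnerCLM_apply, add_comm]

variable {n : ℕ} {M : Type*} [TopologicalSpace M]
  [ChartedSpace (EuclideanSpace ℝ (Fin n)) M] [IsManifold (𝓡 n) ∞ M]

theorem SmoothFieldAt.diffFieldAt {X : VField n M} {x : M} (hX : SmoothFieldAt X x) :
    DiffFieldAt X x :=
  hX.mdifferentiableAt (by simp)

variable {m : Metric n M} {k : ℕ} {f : M → EuclideanSpace ℝ (Fin k)}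

theorem mdifferentiableAt_diff_field (hf : IsIsometricImmersion m f) {x : M} {X : VField n M}
    (hX : DiffFieldAt X x) :
    MDifferentiableAt (𝓡 n) 𝓘(ℝ, EuclideanSpace ℝ (Fin k)) (fun y ↦ diff f y (X y)) x :=
  mdifferentiableAt_mvfderiv_field hf.1.1 hX

theorem diff_mlieBracket (hf : IsIsometricImmersion m f) {x : M} {X Y : VField n M}
    (hX : DiffFieldAt X x) (hY : DiffFieldAt Y x) :
    diff f x (mlieBracket (𝓡 n) X Y x) =
      diff (fun y ↦ diff f y (Y y)) x (X x) - diff (fun y ↦ diff f y (X y)) x (Y x) :=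
  (mvfderiv_mvfderiv_sub hf.1.1 hX hY).symm

theorem mvfderiv_metric_apply (hf : IsIsometricImmersion m f) {x : M} {Y Z : VField n M}
    (hY : DiffFieldAt Y x) (hZ : DiffFieldAt Z x) (v : TangentSpace (𝓡 n) x) :
    mvfderiv (𝓡 n) (fun y ↦ m.inner y (Y y) (Z y)) x v =
      inner ℝ (diff (fun y ↦ diff f y (Y y)) x v) (diff f x (Z x)) +
        inner ℝ (diff f x (Y x)) (diff (fun y ↦ diff f y (Z y)) x v) := by
  have h : (fun y ↦ m.inner y (Y y) (Z y)) =
      fun y ↦ inner ℝ (diff f y (Y y)) (diff f y (Z y)) :=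
    funext fun y ↦ (hf.2 y _ _).symm
  rw [h]
  exact mvfderiv_inner_apply (mdifferentiableAt_diff_field hf hY)
    (mdifferentiableAt_diff_field hf hZ) v

/-- The tangential part of the flat derivative is the Levi-Civita derivative: writing each Koszul
term through derivatives of df along fields, with brackets as differences of these, everything
cancels except the left-hand side. -/
theorem inner_diff_diff (hf : IsIsometricImmersion m f) {x : M} {X Y Z : VField n M}
    (hX : DiffFieldAt X x) (hY : DiffFieldAt Y x) (hZ : DiffFieldAt Z x) :
    inner ℝ (diff (fun y ↦ diff f y (Y y)) x (X x)) (diff f x (Z x)) =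
      m.inner x (leviCivita m Y x (X x)) (Z x) := by
  have h0 : m.inner x (leviCivita m Y x (X x)) (Z x) = koszul m Y X Z x :=
    inner_leviCivitaFun m hY hX hZ
  rw [h0, koszul, mvfderiv_metric_apply hf hY hZ, mvfderiv_metric_apply hf hZ hX,
    mvfderiv_metric_apply hf hX hY, ← hf.2, ← hf.2, ← hf.2, diff_mlieBracket hf hX hY,
    diff_mlieBracket hf hY hZ, diff_mlieBracket hf hZ hX]
  simp only [inner_sub_left]
  rw [real_inner_comm _ (diff f x (Y x)), real_inner_comm _ (diff f x (Z x)),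
    real_inner_comm _ (diff f x (X x))]
  ring

section Normal

variable {f N : M → EuclideanSpace ℝ (Fin (n + 1))}

/-- The map (v, t) ↦ df(v) + tN is injective between spaces of dimension n + 1, hence surjective. -/
theorem exists_eq_diff_add_normal (hf : IsSmoothImmersion (n := n) f) (hN : IsUnitNormal f N)
    (x : M) (w : EuclideanSpace ℝ (Fin (n + 1))) :
    ∃ (v : TangentSpace (𝓡 n) x) (t : ℝ), w = diff f x v + t • N x := by
  let L : TangentSpace (𝓡 n) x × ℝ →ₗ[ℝ] EuclideanSpace ℝ (Fin (n + 1)) :=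
    (diff (n := n) f x).toLinearMap.coprod
      (LinearMap.toSpanSingleton ℝ _ (N x))
  have hL : ∀ p, L p = diff f x p.1 + p.2 • N x := fun p ↦ by simp [L]
  have hinj : Function.Injective L := by
    rw [injective_iff_map_eq_zero]
    rintro ⟨v, t⟩ h
    rw [hL] at h
    have ht : t = 0 := by
      have h1 := congrArg (fun w ↦ inner ℝ w (N x)) h
      simpa [inner_add_left, hN.normal, inner_smul_left, hN.norm_eq_one] using h1
    subst ht
    have hv : v = 0 := hf.2 x (by simpa using h)
    rw [hv]
    rfl
  have hrank : Module.finrank ℝ (TangentSpace (𝓡 n) x × ℝ) =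
      Module.finrank ℝ (EuclideanSpace ℝ (Fin (n + 1))) := by
    rw [Module.finrank_prod]
    have : Module.finrank ℝ (TangentSpace (𝓡 n) x) = n := finrank_euclideanSpace_fin (𝕜 := ℝ)
    rw [this]
    simp
  obtain ⟨⟨v, t⟩, h⟩ := (LinearMap.injective_iff_surjective_of_finrank_eq_finrank hrank).1 hinj w
  exact ⟨v, t, by rw [← h, hL]⟩

theorem ext_diff_normal (hf : IsSmoothImmersion (n := n) f) (hN : IsUnitNormal f N)
    {x : M} {a b : EuclideanSpace ℝ (Fin (n + 1))}
    (h : ∀ v : TangentSpace (𝓡 n) x, inner ℝ a (diff (n := n) f x v) =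
      inner ℝ b (diff (n := n) f x v))
    (h' : inner ℝ a (N x) = inner ℝ b (N x)) : a = b := by
  rw [← sub_eq_zero]
  obtain ⟨v, t, hw⟩ := exists_eq_diff_add_normal hf hN x (a - b)
  have : inner ℝ (a - b) (a - b) = 0 := by
    nth_rw 2 [hw]
    rw [inner_add_right, inner_smul_right, inner_sub_left, inner_sub_left, h v, h']
    ring
  exact inner_self_eq_zero.1 this

theorem IsUnitNormal.mdifferentiableAt (hN : IsUnitNormal f N) (x : M) :
    MDifferentiableAt (𝓡 n) 𝓘(ℝ, EuclideanSpace ℝ (Fin (n + 1))) N x :=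
  (hN.smooth x).mdifferentiableAt (by simp)

theorem inner_diff_normal_self (hN : IsUnitNormal f N) (x : M) (u : TangentSpace (𝓡 n) x) :
    inner ℝ (diff N x u) (N x) = 0 := by
  have h := mvfderiv_inner_apply (hN.mdifferentiableAt x) (hN.mdifferentiableAt x) u
  have hc : (fun y ↦ inner ℝ (N y) (N y)) = fun _ : M ↦ (1 : ℝ) := by
    ext y
    simp [hN.norm_eq_one]
  rw [hc, mvfderiv_const] at h
  have h' : (0 : ℝ) = inner ℝ (diff N x u) (N x) + inner ℝ (N x) (diff N x u) := h
  linarith [real_inner_comm (N x) (diff N x u)]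

/-- The Weingarten formula. -/
theorem diff_normal (hf : IsIsometricImmersion m f) (hN : IsUnitNormal f N) (x : M)
    (u : TangentSpace (𝓡 n) x) :
    diff N x u = -diff f x (shapeOperator m f N x u) := by
  refine ext_diff_normal (x := x) hf.1 hN (fun v ↦ ?_) ?_
  · rw [inner_neg_left, hf.2, inner_shapeOperator, neg_neg]
  · rw [inner_neg_left, hN.normal, inner_diff_normal_self hN, neg_zero]

/-- Differentiate ⟨df(Y), N⟩ = 0. -/
theorem inner_diff_diff_normal (hf : IsIsometricImmersion m f) (hN : IsUnitNormal f N) {x : M}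
    {Y : VField n M} (hY : DiffFieldAt Y x) (u : TangentSpace (𝓡 n) x) :
    inner ℝ (diff (fun y ↦ diff f y (Y y)) x u) (N x) =
      m.inner x (shapeOperator m f N x u) (Y x) := by
  have h := mvfderiv_inner_apply (mdifferentiableAt_diff_field hf hY) (hN.mdifferentiableAt x) u
  have hc : (fun y ↦ inner ℝ (diff f y (Y y)) (N y)) = fun _ : M ↦ (0 : ℝ) :=
    funext fun y ↦ hN.normal y _
  rw [hc, mvfderiv_const] at h
  have h' : (0 : ℝ) = inner ℝ (diff (fun y ↦ diff f y (Y y)) x u) (N x) +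
      inner ℝ (diff f x (Y x)) (diff N x u) := h
  rw [inner_shapeOperator]
  linarith [real_inner_comm (diff f x (Y x)) (diff N x u)]

/-- The Gauss formula. -/
theorem diff_diff (hf : IsIsometricImmersion m f) (hN : IsUnitNormal f N) {x : M}
    {Y : VField n M} (hY : DiffFieldAt Y x) (u : TangentSpace (𝓡 n) x) :
    diff (fun y ↦ diff f y (Y y)) x u =
      diff f x (leviCivita m Y x u) + m.inner x (shapeOperator m f N x u) (Y x) • N x := by
  obtain ⟨X, hX, rfl⟩ := exists_smoothFieldAt x u
  refine ext_diff_normal (x := x) hf.1 hN (fun v ↦ ?_) ?_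
  · obtain ⟨Z, hZ, rfl⟩ := exists_smoothFieldAt x v
    rw [inner_diff_diff hf (SmoothFieldAt.diffFieldAt hX) hY (SmoothFieldAt.diffFieldAt hZ),
      inner_add_left, hf.2, inner_smul_left, real_inner_comm, hN.normal, mul_zero, add_zero]
  · rw [inner_diff_diff_normal hf hN hY, inner_add_left, hN.normal, inner_smul_left,
      real_inner_self_eq_norm_sq, hN.norm_eq_one]
    simp

/-- The vector df[X,Y] is tangent; its vanishing normal component is ⟨AX,Y⟩ - ⟨AY,X⟩. -/
theorem shapeOperator_selfAdjoint (hf : IsIsometricImmersion m f) (hN : IsUnitNormal f N) (x : M)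
    (u v : TangentSpace (𝓡 n) x) :
    m.inner x (shapeOperator m f N x u) v = m.inner x u (shapeOperator m f N x v) := by
  obtain ⟨X, hX, rfl⟩ := exists_smoothFieldAt x u
  obtain ⟨Y, hY, rfl⟩ := exists_smoothFieldAt x v
  have hX' := SmoothFieldAt.diffFieldAt hX
  have hY' := SmoothFieldAt.diffFieldAt hY
  have h := hN.normal x (mlieBracket (𝓡 n) X Y x)
  rw [diff_mlieBracket hf hX' hY', inner_sub_left, inner_diff_diff_normal hf hN hY',
    inner_diff_diff_normal hf hN hX', sub_eq_zero] at h
  rw [h, m.symm]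

end Normal

end Hypersurface

/-! ### The closed forms df ∘ Q and ⟨F, df⟩ -/

section CodazziTensors

theorem contMDiffAt_inner_apply {E : Type*} [NormedAddCommGroup E] [NormedSpace ℝ E]
    {M : Type*} [TopologicalSpace M] [ChartedSpace E M]
    {V : Type*} [NormedAddCommGroup V] [InnerProductSpace ℝ V] {a b : M → V} {x : M}
    (ha : ContMDiffAt 𝓘(ℝ, E) 𝓘(ℝ, V) ∞ a x) (hb : ContMDiffAt 𝓘(ℝ, E) 𝓘(ℝ, V) ∞ b x) :
    ContMDiffAt 𝓘(ℝ, E) 𝓘(ℝ, ℝ) ∞ (fun y ↦ inner ℝ (a y) (b y)) x := by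
  have h : ContDiff ℝ ∞ (fun p : V × V ↦ inner ℝ p.1 p.2) := contDiff_inner
  exact h.contMDiff.contMDiffAt.comp x (ha.prodMk_space hb)

variable {n : ℕ} {M : Type*} [TopologicalSpace M]
  [ChartedSpace (EuclideanSpace ℝ (Fin n)) M] [IsManifold (𝓡 n) ∞ M]
  {m : Metric n M} {f N : M → EuclideanSpace ℝ (Fin (n + 1))} {Q : EndoField n M}

/-- The one-form `df ∘ Q`. -/
def diffComp (f : M → EuclideanSpace ℝ (Fin (n + 1))) (Q : EndoField n M) (x : M) :
    TangentSpace (𝓡 n) x →L[ℝ] EuclideanSpace ℝ (Fin (n + 1)) :=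
  (diff f x).comp (Q x)

theorem smoothOneForm_diffComp (hf : IsIsometricImmersion m f) (hQ : Q.Smooth) :
    SmoothOneForm (diffComp f Q) := fun _ _ hX ↦
  contMDiffAt_mvfderiv_field hf.1.1 (hQ.apply hX)

/-- The product QA of commuting self-adjoint operators is self-adjoint. This removes the normal
component in the closedness of df ∘ Q. -/
theorem inner_shapeOperator_comm (hf : IsIsometricImmersion m f) (hN : IsUnitNormal f N)
    (hQ : IsCodazzi m Q)
    (hcomm : ∀ x, (Q x).comp (shapeOperator m f N x) = (shapeOperator m f N x).comp (Q x))
    (x : M) (u v : TangentSpace (𝓡 n) x) :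
    m.inner x (shapeOperator m f N x u) (Q x v) = m.inner x (shapeOperator m f N x v) (Q x u) := by
  have h : Q x (shapeOperator m f N x u) = shapeOperator m f N x (Q x u) :=
    DFunLike.congr_fun (hcomm x) u
  rw [← hQ.selfAdjoint, h, shapeOperator_selfAdjoint hf hN, m.symm]

/-- The Codazzi equation and zero torsion settle the tangential component;
`inner_shapeOperator_comm` settles the normal one. -/
theorem closedOneForm_diffComp (hf : IsIsometricImmersion m f) (hN : IsUnitNormal f N)
    (hQ : IsCodazzi m Q)
    (hcomm : ∀ x, (Q x).comp (shapeOperator m f N x) = (shapeOperator m f N x).comp (Q x)) :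
    ClosedOneForm (diffComp f Q) := by
  intro x X Y hX hY
  have hX' : DiffFieldAt X x := SmoothFieldAt.diffFieldAt hX
  have hY' : DiffFieldAt Y x := SmoothFieldAt.diffFieldAt hY
  have hQX : DiffFieldAt (fun y ↦ Q y (X y)) x := SmoothFieldAt.diffFieldAt (hQ.smooth.apply hX)
  have hQY : DiffFieldAt (fun y ↦ Q y (Y y)) x := SmoothFieldAt.diffFieldAt (hQ.smooth.apply hY)
  have h1 := diff_diff hf hN hQY (X x)
  have h2 := diff_diff hf hN hQX (Y x)
  have h3 : leviCivita m (fun y ↦ Q y (Y y)) x (X x) - leviCivita m (fun y ↦ Q y (X y)) x (Y x) =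
      Q x (mlieBracket (𝓡 n) X Y x) := by
    have := hQ.codazzi x X Y hX hY
    rw [← leviCivita_torsion_free m hX' hY', map_sub, sub_eq_sub_iff_add_eq_add]
    rw [sub_eq_sub_iff_add_eq_add] at this
    rw [this, add_comm]
  have h4 : diff (fun y ↦ diff f y (Q y (Y y))) x (X x) -
      diff (fun y ↦ diff f y (Q y (X y))) x (Y x) = diff f x (Q x (mlieBracket (𝓡 n) X Y x)) := by
    rw [h1, h2, inner_shapeOperator_comm hf hN hQ hcomm x (X x) (Y x), add_sub_add_right_eq_sub,
      ← map_sub, h3]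
  exact h4

/-- The one-form `X ↦ ⟨F, df(X)⟩`. -/
def innerDiff (F f : M → EuclideanSpace ℝ (Fin (n + 1))) (x : M) :
    TangentSpace (𝓡 n) x →L[ℝ] ℝ :=
  (innerSL ℝ (F x)).comp (diff f x)

theorem smoothOneForm_innerDiff {F : M → EuclideanSpace ℝ (Fin (n + 1))}
    (hF : ContMDiff (𝓡 n) (𝓡 (n + 1)) ∞ F) (hf : IsIsometricImmersion m f) :
    SmoothOneForm (innerDiff F f) := fun x _ hX ↦
  contMDiffAt_inner_apply (hF x) (contMDiffAt_mvfderiv_field hf.1.1 hX)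

/-- By the Leibniz rule, the terms ⟨dF(X), df(Y)⟩ = ⟨QX,Y⟩ cancel by self-adjointness of Q; those
differentiating df combine to ⟨F, df[X,Y]⟩. -/
theorem closedOneForm_innerDiff {F : M → EuclideanSpace ℝ (Fin (n + 1))}
    (hF : ContMDiff (𝓡 n) (𝓡 (n + 1)) ∞ F) (hf : IsIsometricImmersion m f) (hQ : IsCodazzi m Q)
    (hFQ : ∀ x, diff (n := n) F x = (diff f x).comp (Q x)) :
    ClosedOneForm (innerDiff F f) := by
  intro x X Y hX hY
  have hX' : DiffFieldAt X x := SmoothFieldAt.diffFieldAt hX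
  have hY' : DiffFieldAt Y x := SmoothFieldAt.diffFieldAt hY
  have hF' := (hF x).mdifferentiableAt (by simp)
  have h1 := mvfderiv_inner_apply hF' (mdifferentiableAt_diff_field hf hY') (X x)
  have h2 := mvfderiv_inner_apply hF' (mdifferentiableAt_diff_field hf hX') (Y x)
  have h3 := diff_mlieBracket hf hX' hY'
  have h4 : ∀ u v : TangentSpace (𝓡 n) x, inner ℝ (diff F x u) (diff f x v) =
      m.inner x (Q x u) v := fun u v ↦ by
    rw [hFQ]
    exact hf.2 x _ _
  have h5 : inner ℝ (diff F x (X x)) (diff f x (Y x)) =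
      inner ℝ (diff F x (Y x)) (diff f x (X x)) := by
    rw [h4, h4, hQ.selfAdjoint, m.symm]
  have h6 : inner ℝ (F x) (diff f x (mlieBracket (𝓡 n) X Y x)) =
      inner ℝ (F x) (diff (fun y ↦ diff f y (Y y)) x (X x)) -
        inner ℝ (F x) (diff (fun y ↦ diff f y (X y)) x (Y x)) := by
    rw [h3, inner_sub_right]
  refine (congrArg₂ (· - ·) h1 h2).trans (Eq.trans ?_ h6.symm)
  exact (congrArg (fun t ↦ t + _ - _) h5).trans (add_sub_add_left_eq_sub _ _ _)

/-- If `F = df(grad g) + h N`, then the tangential and normal components of `dF`. -/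
theorem diff_support {F : M → EuclideanSpace ℝ (Fin (n + 1))} (hf : IsIsometricImmersion m f)
    (hN : IsUnitNormal f N) {Y : VField n M} {h : M → ℝ} {x : M} (hY : DiffFieldAt Y x)
    (hh : MDifferentiableAt (𝓡 n) 𝓘(ℝ, ℝ) h x)
    (hF : F = fun y ↦ diff f y (Y y) + h y • N y) (u : TangentSpace (𝓡 n) x) :
    diff F x u = diff f x (leviCivita m Y x u - h x • shapeOperator m f N x u) +
      (m.inner x (shapeOperator m f N x u) (Y x) + mvfderiv (𝓡 n) h x u) • N x := by
  have h1 := mdifferentiableAt_diff_field hf hY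
  have h2 := hN.mdifferentiableAt x
  have h3 : diff F x u = diff (fun y ↦ diff f y (Y y)) x u +
      (h x • diff N x u + mvfderiv (𝓡 n) h x u • N x) := by
    rw [hF]
    refine (DFunLike.congr_fun (mvfderiv_add h1 (hh.smul h2)) u).trans ?_
    exact congrArg (_ + ·) (DFunLike.congr_fun (mvfderiv_smul hh h2) u)
  rw [h3, diff_diff hf hN hY, diff_normal hf hN, map_sub, map_smul, add_smul, smul_neg]
  abel

end CodazziTensors

end

end CodazziHypersurface

/-! ### The main theorem -/

open CodazziHypersurface
theorem proposition3 {n : ℕ} {M : Type*} [TopologicalSpace M]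
    [ChartedSpace (EuclideanSpace ℝ (Fin n)) M] [IsManifold (𝓡 n) ∞ M]
    [T2Space M] [SecondCountableTopology M] [SimplyConnectedSpace M]
    (m : Metric n M)
    (f : M → EuclideanSpace ℝ (Fin (n + 1))) (hf : IsIsometricImmersion m f)
    (N : M → EuclideanSpace ℝ (Fin (n + 1))) (hN : IsUnitNormal f N)
    (A : EndoField n M) (hA : A = shapeOperator m f N)
    (Q : EndoField n M) (hQ : IsCodazzi m Q)
    (hns : ∀ x, Function.Bijective (Q x))
    (hcomm : ∀ x, (Q x).comp (A x) = (A x).comp (Q x)) :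
    ∃ F : M → EuclideanSpace ℝ (Fin (n + 1)),
      IsSmoothImmersion (n := n) F ∧
      (∀ x, diff (n := n) F x = (diff f x).comp (Q x)) ∧
      (∃ g h : M → ℝ,
        ContMDiff (𝓡 n) 𝓘(ℝ, ℝ) ∞ g ∧ ContMDiff (𝓡 n) 𝓘(ℝ, ℝ) ∞ h ∧
        (∀ x, A x (grad m g x) = -grad m h x) ∧
        (∀ (x : M) (u : TangentSpace (𝓡 n) x),
          Q x u = leviCivita m (grad m g) x u - h x • A x u) ∧
        (∀ x, F x = diff f x (grad m g x) + h x • N x)) ∧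
      (∃ m' : Metric n M,
        (∀ (x : M) (u v : TangentSpace (𝓡 n) x), m'.inner x u v = m.inner x (Q x (Q x u)) v) ∧
        IsIsometricImmersion m' F) := by
  subst hA
  obtain ⟨F, hF⟩ := exists_primitive (smoothOneForm_diffComp hf hQ.smooth)
    (closedOneForm_diffComp hf hN hQ hcomm)
  have hFs := contMDiff_of_hasMFDerivAt (smoothOneForm_diffComp hf hQ.smooth) hF
  have hFQ : ∀ x, diff (n := n) F x = (diff f x).comp (Q x) := fun x ↦ (hF x).mfderiv
  have himm : IsSmoothImmersion (n := n) F := by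
    refine ⟨hFs, fun x ↦ ?_⟩
    rw [hFQ]
    exact (hf.1.2 x).comp (hns x).1
  have hη := smoothOneForm_innerDiff hFs hf
  obtain ⟨g, hg⟩ := exists_primitive hη (closedOneForm_innerDiff hFs hf hQ hFQ)
  have hgs := contMDiff_of_hasMFDerivAt hη hg
  -- This says that df(grad g) is the tangential part of F.
  have hgrad : ∀ (x : M) (v : TangentSpace (𝓡 n) x),
      m.inner x (grad m g x) v = inner ℝ (F x) (diff f x v) := fun x v ↦
    (inner_sharp m x _ _).trans (DFunLike.congr_fun (hg x).mfderiv v)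
  let h : M → ℝ := fun y ↦ inner ℝ (F y) (N y)
  have hhs : ContMDiff (𝓡 n) 𝓘(ℝ, ℝ) ∞ h := fun x ↦
    contMDiffAt_inner_apply (hFs x) (hN.smooth x)
  have hdecomp : ∀ x, F x = diff f x (grad m g x) + h x • N x := by
    intro x
    refine ext_diff_normal (x := x) hf.1 hN (fun v ↦ ?_) ?_
    · rw [inner_add_left, hf.2, hgrad, inner_smul_left, real_inner_comm (diff f x v) (N x),
        hN.normal, mul_zero, add_zero]
    · rw [inner_add_left, hN.normal, inner_smul_left, real_inner_self_eq_norm_sq, hN.norm_eq_one]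
      simp [h]
  -- Two expressions for dF(u): df(Qu), and the derivative of the decomposition `hdecomp`.
  have hd : ∀ (x : M) (u : TangentSpace (𝓡 n) x),
      diff f x (Q x u) = diff f x (leviCivita m (grad m g) x u - h x • shapeOperator m f N x u) +
        (m.inner x (shapeOperator m f N x u) (grad m g x) + mvfderiv (𝓡 n) h x u) • N x := by
    intro x u
    rw [← diff_support hf hN (smoothFieldAt_grad m hgs x).diffFieldAt
      ((hhs x).mdifferentiableAt (by simp)) (funext hdecomp), hFQ]
    rfl
  -- The left side of `hd` is tangent, so the coefficient of N vanishes.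
  have hnormal : ∀ (x : M) (u : TangentSpace (𝓡 n) x),
      m.inner x (shapeOperator m f N x u) (grad m g x) + mvfderiv (𝓡 n) h x u = 0 := by
    intro x u
    have h1 := congrArg (fun w ↦ inner ℝ w (N x)) (hd x u)
    simp only [inner_add_left, hN.normal, inner_smul_left, real_inner_self_eq_norm_sq,
      hN.norm_eq_one] at h1
    simpa using h1.symm
  refine ⟨F, himm, hFQ, ⟨g, h, hgs, hhs, fun x ↦ ?_, fun x u ↦ ?_, hdecomp⟩,
    squareMetric m Q hQ.smooth hQ.selfAdjoint hns, fun _ _ _ ↦ rfl, himm, fun x u v ↦ ?_⟩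
  · refine eq_of_inner_eq m fun Z _ ↦ ?_
    have h1 : m.inner x (grad m h x) (Z x) = mvfderiv (𝓡 n) h x (Z x) := inner_sharp m x _ _
    rw [map_neg, neg_apply, h1, shapeOperator_selfAdjoint hf hN, m.symm]
    linarith [hnormal x (Z x)]
  · apply hf.1.2 x
    rw [hd, hnormal, zero_smul, add_zero]
  · change _ = m.inner x (Q x (Q x u)) v
    rw [hFQ, hQ.selfAdjoint]
    exact hf.2 x _ _
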